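/- All graphs are finite and simple, and $\log$ denotes the logarithm to base $2$. An $n$-vertex, $d$-regular graph $G$ is called a $\lambda$-expander if $$\left|e(S,T)-\frac dn|S||T|\right|\le \lambda\sqrt{|S||T|}\qquad\text{for all } S,T\subseteq V(G),$$ where $e(S,T)$ is the number of edges with one endpoint in $S$ and the other in $T$, counted twice if both endpoints lie in $S\cap T$. For a positive integer $M$ and a vertex $v_0$ of a connected graph $G$, let $\mathrm{Lip}_{v_0}(G;M)$ be the (finite) set of functions $f:V(G)\to\mathbb Z$ with $f(v_0)=0$ and $|f(u)-f(v)|\le M$ for every edge $uv$ of $G$. The range of $f$ is $R(f)=\max_{v}f(v)-\min_{v}f(v)+1$. **Theorem.** There exist universal constants $c,C,c',C',K>0$ such that the following holds. Let $M$ be a positive integer and let $G$ be a connected $n$-vertex, $d$-regular $\lambda$-expander with $\lambda\le d/5\le cn$ and $$M\le\min\left\{c\,\frac{d^{3/2}}{\lambda\log d},\ (\log n)^C\right\}.$$ Fix $v_0\in V(G)$ and let $f$ be chosen uniformly at random from $\mathrm{Lip}_{v_0}(G;M)$. Then $$\mathbb P\left(R(f)\ge C'M\,\frac{\log\log n}{\log(d/\lambda)}+2(M+1)\right)\le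 n^{-c'}.$$ Furthermore, for every $v\in V(G)$, $$\mathrm{Var}(f(v))\le K\left(M\max\left\{1,\left\lceil\frac{\log M}{\log\left(d/(2\lambda)\right)}\right\rceil\right\}\right)^2 .$$ -/

import Mathlib

/-- A `d`-regular graph on `n` vertices is a `lam`-expander if
`|e(S,T) - (d/n) |S| |T|| ≤ lam * √(|S| |T|)` for all vertex sets `S`, `T`.
The number `e(S,T)` is the number of pairs `(u, v) ∈ S × T` with `u` adjacent to `v`, that is, the
number of edges with one endpoint in `S` and the other in `T`, where an edge with both endpoints
in `S ∩ T` is counted twice. -/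
def IsLambdaExpander {V : Type*} [Fintype V] (G : SimpleGraph V) [DecidableRel G.Adj]
    (d : ℕ) (lam : ℝ) : Prop :=
  G.IsRegularOfDegree d ∧
    ∀ S T : Finset V,
      |((G.interedges S T).card : ℝ) - (d : ℝ) / (Fintype.card V : ℝ) * S.card * T.card|
        ≤ lam * √((S.card : ℝ) * (T.card : ℝ))

/-- The set of integer-valued functions `f` on the vertices with `f v₀ = 0` and
`|f u - f v| ≤ M` for every edge `uv`. -/
def lipschitzFunctions {V : Type*} (G : SimpleGraph V) (v₀ : V) (M : ℕ) : Set (V → ℤ) :=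
  {f | f v₀ = 0 ∧ ∀ u v : V, G.Adj u v → |f u - f v| ≤ (M : ℤ)}

/-- The range `R(f) = max f - min f + 1` of an integer-valued function on a finite nonempty set. -/
noncomputable def functionRange {V : Type*} (f : V → ℤ) : ℤ :=
  (⨆ v, f v) - (⨅ v, f v) + 1

/-- The law of a uniformly random element of the (finite, nonempty when `G` is finite and
connected) set `lipschitzFunctions G v₀ M`, as a measure on `V → ℤ`. -/
noncomputable def uniformLipschitz {V : Type*} (G : SimpleGraph V) (v₀ : V) (M : ℕ) :
    MeasureTheory.Measure (V → ℤ) :=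
  ProbabilityTheory.uniformOn (lipschitzFunctions G v₀ M)

/-!
The idea is a Peierls argument in which the values of a function on an excursion are resampled.

After translating a Lipschitz function `f` suitably (`IsCentred`, `exists_isCentred_add`), its bulk
is the interval `[0, M]`: at most two fifths of the vertices lie above it and at most two fifths
below it. An excursion is a maximal set of vertices outside the bulk that hangs together through
steps of length at most `3`. For every level `j` and either side of the bulk, the part of the
excursion beyond level `M + j` (or its mirror image) contains a sparse set `Y` whose neighbourhood,
the front, contains `99` percent of the neighbours of each vertex of that part
(`exists_isApprox`). Hence that part lies in a set determined by `Y`, the hull, and by expansion the hull has at most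
two thirds of the size of the front (`three_mul_card_core_le`). The sets `Y` form the record of the
excursion (`IsCertificate`, `exists_isCertificate`), and the total size `w` of its fronts is the
weight of the record.

Given the record, a vertex `u` of the region covered by fronts and hulls admits at most
`M + 1 + h - p` values, where `h` and `p` are the numbers of hulls and of fronts containing `u`. On
the other hand, all neighbours of the region outside it are in the bulk, so arbitrary values in
`[0, M]` on the region again give a Lipschitz function, still with a large bulk. Comparing the two
shows that the functions with a given record are a proportion of at most `exp (-w / (3 (M + 1)))`
of all functions with a large bulk (`card_certified_le`), and there are at most `5 (M + 1)` times
as many of the latter as functions pinned at a vertex (`exists_bulk_functions`). Because the sets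
`Y` are sparse, a record of weight `w` has at most `100 w / d` elements; it is linked, so it is
traced by a walk of comparable length (`IsLinked.exists_tour`), and there are at most
`exp (O(w log d / d))` such records. The expander condition applied to a single vertex gives
`lam ≥ √d / 2` (`sqrt_le_two_mul_lam`), hence `M` is at most a small multiple of `d / log d`
(`parameters_of_le`), and the entropy of the records is beaten: the weight of the excursion at a
given vertex has a bounded exponential moment (`sum_exp_weight_le`, `exists_excursion_weight`).

The weight controls the height of the excursion in two ways. It is at least `99 d / 100` times the
height, since a vertex beyond a level has almost all of its neighbours in the front of that level;
so the distance of `f v` from the bulk has a bounded second moment, which bounds the variance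
by `O(M ^ 2)` (`sum_sq_centred_le`). And each step of height `M` towards the bulk multiplies the
superlevel sets by a constant multiple of `(d / lam) ^ 2`, so an excursion of height of order
`M log log n / log (d / lam)` has weight at least `16 (M + 1) log n` (`two_mul_log_le_weight`), and
a union bound over the vertices (`card_heavy_le`) bounds the range.
-/

set_option linter.unusedSectionVars false

/-! ### Neighbourhoods, cores and sparse approximations -/

namespace FlatLipschitz

open Finset

section Approximation

variable {V : Type*} [Fintype V] [DecidableEq V] (G : SimpleGraph V) [DecidableRel G.Adj]

/-- The set of vertices with at least one neighbour in `Y`. -/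
def nbhd (Y : Finset V) : Finset V := Y.biUnion fun v => G.neighborFinset v

/-- The vertices of a `d`-regular graph with at most a hundredth of their neighbours outside `F`. -/
def core (d : ℕ) (F : Finset V) : Finset V :=
  univ.filter fun v => 100 * (G.neighborFinset v \ F).card ≤ d

/-- A set whose neighbourhood has at least `d / 100` vertices per element. -/
def IsSparse (d : ℕ) (Y : Finset V) : Prop := d * Y.card ≤ 100 * (nbhd G Y).card

/-- `Y` approximates `X`: it is a sparse subset of `X`, and its neighbourhood contains almost all
neighbours of each vertex of `X`. -/
structure IsApprox (d : ℕ) (X Y : Finset V) : Prop where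
  subset : Y ⊆ X
  sparse : IsSparse G d Y
  subset_core : X ⊆ core G d (nbhd G Y)

variable {G}

lemma mem_nbhd {Y : Finset V} {u : V} : u ∈ nbhd G Y ↔ ∃ y ∈ Y, G.Adj y u := by
  simp [nbhd]

lemma mem_core {d : ℕ} {F : Finset V} {v : V} :
    v ∈ core G d F ↔ 100 * (G.neighborFinset v \ F).card ≤ d := by
  simp [core]

lemma nbhd_empty : nbhd G ∅ = ∅ := by simp [nbhd]

lemma card_neighborFinset_of_regular {d : ℕ} (hreg : G.IsRegularOfDegree d) (v : V) :
    (G.neighborFinset v).card = d := hreg v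

lemma le_card_inter_of_mem_core {d : ℕ} (hreg : G.IsRegularOfDegree d) {F : Finset V} {v : V}
    (hv : v ∈ core G d F) : 99 * d ≤ 100 * (G.neighborFinset v ∩ F).card := by
  have h1 := Finset.card_inter_add_card_sdiff (G.neighborFinset v) F
  rw [card_neighborFinset_of_regular hreg] at h1
  have := mem_core.1 hv
  omega

lemma exists_adj_of_mem_core {d : ℕ} (hreg : G.IsRegularOfDegree d) (hd : 0 < d) {F : Finset V}
    {v : V} (hv : v ∈ core G d F) : ∃ u ∈ F, G.Adj v u := by
  have h := le_card_inter_of_mem_core hreg hv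
  have : 0 < (G.neighborFinset v ∩ F).card := by omega
  obtain ⟨u, hu⟩ := Finset.card_pos.1 this
  rw [mem_inter, SimpleGraph.mem_neighborFinset] at hu
  exact ⟨u, hu.2, hu.1⟩

/-- Greedy approximation: a sparse subset of `X` of maximal size approximates `X`, since a vertex
of `X` outside the core could be added to it. -/
lemma exists_isApprox (d : ℕ) (X : Finset V) : ∃ Y, IsApprox G d X Y := by
  classical
  have hne : (X.powerset.filter fun Y => IsSparse G d Y).Nonempty :=
    ⟨∅, by rw [mem_filter]; exact ⟨by simp, by simp [IsSparse]⟩⟩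
  obtain ⟨Y, hY, hmax⟩ := Finset.exists_max_image _ Finset.card hne
  rw [mem_filter, mem_powerset] at hY
  refine ⟨Y, hY.1, hY.2, fun v hv => ?_⟩
  by_contra hcore
  rw [mem_core, not_le] at hcore
  have hvY : v ∉ Y := by
    intro hvY
    have : G.neighborFinset v \ nbhd G Y = ∅ := by
      rw [sdiff_eq_empty_iff_subset]
      intro u hu
      exact mem_nbhd.2 ⟨v, hvY, by simpa using hu⟩
    rw [this] at hcore
    simp at hcore
  have hcard : (nbhd G (insert v Y)).card
      = (G.neighborFinset v \ nbhd G Y).card + (nbhd G Y).card := by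
    have : nbhd G (insert v Y) = (G.neighborFinset v \ nbhd G Y) ∪ nbhd G Y := by
      rw [sdiff_union_self_eq_union]
      simp [nbhd, biUnion_insert]
    rw [this, card_union_of_disjoint sdiff_disjoint]
  have hs : IsSparse G d (insert v Y) := by
    have := hY.2
    unfold IsSparse at this ⊢
    rw [hcard, card_insert_of_notMem hvY]
    nlinarith
  have := hmax (insert v Y) (by
    rw [mem_filter, mem_powerset]
    exact ⟨insert_subset hv hY.1, hs⟩)
  rw [card_insert_of_notMem hvY] at this
  omega

lemma card_interedges_eq_sum (S T : Finset V) :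
    (G.interedges S T).card = ∑ v ∈ S, (G.neighborFinset v ∩ T).card := by
  rw [SimpleGraph.interedges_def, Finset.card_filter, Finset.sum_product]
  refine Finset.sum_congr rfl fun v _ => ?_
  rw [← Finset.card_filter]
  congr 1
  ext u
  simp [and_comm]

end Approximation

/-! ### Expansion of cores -/

section Expansion

variable {V : Type*} [Fintype V] [DecidableEq V] {G : SimpleGraph V} [DecidableRel G.Adj]

/-- Small sets `F` have much smaller cores. -/
lemma card_core_mul_le {d : ℕ} {lam : ℝ} (h : IsLambdaExpander G d lam) {F : Finset V}
    (hF : 5 * F.card ≤ 3 * Fintype.card V) :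
    (39 / 100 * (d : ℝ)) ^ 2 * (core G d F).card ≤ lam ^ 2 * F.card := by
  set s : ℝ := ((core G d F).card : ℝ) with hs
  set x : ℝ := (F.card : ℝ) with hx
  have hs0 : 0 ≤ s := by positivity
  have hx0 : 0 ≤ x := by positivity
  rcases hs0.eq_or_lt with h0 | hspos
  · rw [← h0]; simp; positivity
  have hd0 : (0 : ℝ) ≤ d := by positivity
  have hn : (0 : ℝ) < Fintype.card V := by
    have : 0 < (core G d F).card := by rw [hs] at hspos; exact_mod_cast hspos
    obtain ⟨v, -⟩ := Finset.card_pos.1 this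
    exact_mod_cast Fintype.card_pos_iff.2 ⟨v⟩
  have hlow : 99 / 100 * d * s ≤ ((G.interedges (core G d F) F).card : ℝ) := by
    rw [card_interedges_eq_sum]
    push_cast
    have : ∑ v ∈ core G d F, (99 / 100 * (d : ℝ))
        ≤ ∑ v ∈ core G d F, ((G.neighborFinset v ∩ F).card : ℝ) := by
      refine Finset.sum_le_sum fun v hv => ?_
      have := le_card_inter_of_mem_core h.1 hv
      have h2 : (99 : ℝ) * d ≤ 100 * ((G.neighborFinset v ∩ F).card : ℝ) := by exact_mod_cast this
      linarith
    rw [Finset.sum_const, nsmul_eq_mul] at this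
    linarith
  have hup := (abs_le.1 (h.2 (core G d F) F)).2
  rw [← hs, ← hx] at hup
  have hdiv : (d : ℝ) / (Fintype.card V : ℝ) * s * x ≤ 3 / 5 * d * s := by
    have hF' : 5 * x ≤ 3 * (Fintype.card V : ℝ) := by rw [hx]; exact_mod_cast hF
    rw [div_mul_eq_mul_div, div_mul_eq_mul_div, div_le_iff₀ hn]
    have := mul_nonneg hd0 hs0
    nlinarith
  have hkey : 39 / 100 * d * s ≤ lam * √(s * x) := by linarith
  have hsq : (39 / 100 * d * s) ^ 2 ≤ (lam * √(s * x)) ^ 2 :=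
    pow_le_pow_left₀ (by positivity) hkey 2
  rw [mul_pow lam, Real.sq_sqrt (by positivity)] at hsq
  have : s * ((39 / 100 * d) ^ 2 * s) ≤ s * (lam ^ 2 * x) := by nlinarith
  exact le_of_mul_le_mul_left this hspos

lemma three_mul_card_core_le {d : ℕ} {lam : ℝ} (h : IsLambdaExpander G d lam) (hd : 0 < d)
    (hlam0 : 0 ≤ lam) (hlam : lam ≤ (d : ℝ) / 5) {F : Finset V}
    (hF : 5 * F.card ≤ 3 * Fintype.card V) :
    3 * (core G d F).card ≤ 2 * F.card := by
  have h1 := card_core_mul_le h hF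
  have hd' : (0 : ℝ) < d := by exact_mod_cast hd
  have h2 : lam ^ 2 ≤ (d / 5 : ℝ) ^ 2 := pow_le_pow_left₀ hlam0 hlam 2
  have h3 : (39 / 100 * (d : ℝ)) ^ 2 * (core G d F).card ≤ (d / 5 : ℝ) ^ 2 * F.card :=
    h1.trans (mul_le_mul_of_nonneg_right h2 (by positivity))
  have h4 : (d : ℝ) ^ 2 * ((39 / 100) ^ 2 * (core G d F).card) ≤ (d : ℝ) ^ 2 * (1 / 25 * F.card) := by
    linarith
  have h5 := le_of_mul_le_mul_left h4 (by positivity)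
  have h6 : (0 : ℝ) ≤ (core G d F).card := by positivity
  have : (3 : ℝ) * (core G d F).card ≤ 2 * F.card := by nlinarith
  exact_mod_cast this

end Expansion

/-! ### Centring a Lipschitz function -/

section Centring

variable {V : Type*} [Fintype V] [DecidableEq V] (G : SimpleGraph V) [DecidableRel G.Adj]

/-- The vertices all of whose neighbours have value at most `j`. -/
def lowSet (g : V → ℤ) (j : ℤ) : Finset V :=
  univ.filter fun v => ∀ u ∈ G.neighborFinset v, g u ≤ j

/-- A function is centred when `M` is the least level `j` for which some sparse set of vertices
with all neighbours at level at most `j` sees at least three fifths of the graph. The interval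
`[0, M]` is then the bulk of the values. -/
structure IsCentred (d M : ℕ) (g : V → ℤ) : Prop where
  below : ∀ Y ⊆ lowSet G g (M - 1), IsSparse G d Y → 5 * (nbhd G Y).card < 3 * Fintype.card V
  above : ∃ Y ⊆ lowSet G g M, IsSparse G d Y ∧ 3 * Fintype.card V ≤ 5 * (nbhd G Y).card

variable {G}

lemma mem_lowSet {g : V → ℤ} {j : ℤ} {v : V} :
    v ∈ lowSet G g j ↔ ∀ u, G.Adj v u → g u ≤ j := by
  simp [lowSet]

lemma lowSet_add (g : V → ℤ) (s j : ℤ) : lowSet G (fun v => g v + s) j = lowSet G g (j - s) := by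
  ext v
  simp only [mem_lowSet]
  exact forall₂_congr fun u _ => by omega

/-- Every function has a centred translate. -/
lemma exists_isCentred_add {d : ℕ} {lam : ℝ} (h : IsLambdaExpander G d lam) (hd : 0 < d)
    (hlam0 : 0 ≤ lam) (hlam : lam ≤ (d : ℝ) / 5) [Nonempty V] (M : ℕ) (f : V → ℤ) :
    ∃ s : ℤ, IsCentred G d M fun v => f v + s := by
  have hn : 0 < Fintype.card V := Fintype.card_pos
  let P : ℤ → Prop := fun j =>
    ∃ Y ⊆ lowSet G f j, IsSparse G d Y ∧ 3 * Fintype.card V ≤ 5 * (nbhd G Y).card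
  have hbdd : ∃ b, ∀ z, P z → b ≤ z := by
    obtain ⟨b, hb⟩ := (Set.finite_range f).bddBelow
    refine ⟨b, ?_⟩
    rintro z ⟨Y, hY, -, hcard⟩
    have : 0 < (nbhd G Y).card := by omega
    obtain ⟨u, hu⟩ := Finset.card_pos.1 this
    obtain ⟨y, hy, hyu⟩ := mem_nbhd.1 hu
    exact (hb ⟨u, rfl⟩).trans (mem_lowSet.1 (hY hy) u hyu)
  have hinh : ∃ z, P z := by
    obtain ⟨b, hb⟩ := (Set.finite_range f).bddAbove
    obtain ⟨Y, hY⟩ := exists_isApprox (G := G) d (univ : Finset V)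
    refine ⟨b, Y, fun v _ => mem_lowSet.2 fun u _ => hb ⟨u, rfl⟩, hY.sparse, ?_⟩
    by_contra hlt
    have h1 := three_mul_card_core_le h hd hlam0 hlam (F := nbhd G Y) (by omega)
    rw [univ_subset_iff.1 hY.subset_core, card_univ] at h1
    have := card_le_univ (nbhd G Y)
    omega
  obtain ⟨J, hJ, hmin⟩ := Int.exists_least_of_bdd hbdd hinh
  refine ⟨M - J, ⟨fun Y hY hs => ?_, ?_⟩⟩
  · rw [lowSet_add] at hY
    by_contra hlt
    have := hmin (J - 1) ⟨Y, by convert hY using 2; ring, hs, by omega⟩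
    omega
  · obtain ⟨Y, hY, hs, hc⟩ := hJ
    refine ⟨Y, ?_, hs, hc⟩
    rw [lowSet_add]
    convert hY using 2
    ring

end Centring

end FlatLipschitz

/-! ### Counting linked sets -/

namespace FlatLipschitz

open Finset

section Linked

variable {α : Type*} [DecidableEq α]

/-- A finite set `K` is linked from `x` if it contains `x` and every proper subset containing `x`
is joined by the relation `nb` to the rest of `K`. -/
def IsLinked (nb : α → Finset α) (x : α) (K : Finset α) : Prop :=
  x ∈ K ∧ ∀ K' ⊆ K, x ∈ K' → K' ≠ K → ∃ p ∈ K', ∃ q ∈ K, q ∉ K' ∧ q ∈ nb p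

/-- The walks with `k` steps starting at `x`, as lists of their vertices. -/
def tours (nb : α → Finset α) : ℕ → α → Finset (List α)
  | 0, x => {[x]}
  | k + 1, x => (nb x).biUnion fun y => (tours nb k y).image (List.cons x)

lemma card_tours_le (nb : α → Finset α) (D : ℕ) (hD : ∀ x, (nb x).card ≤ D) (k : ℕ) (x : α) :
    (tours nb k x).card ≤ D ^ k := by
  induction k generalizing x with
  | zero => simp [tours]
  | succ k ih =>
    calc (tours nb (k + 1) x).card
        ≤ ∑ y ∈ nb x, ((tours nb k y).image (List.cons x)).card := card_biUnion_le
      _ ≤ ∑ y ∈ nb x, D ^ k := sum_le_sum fun y _ => card_image_le.trans (ih y)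
      _ ≤ D ^ (k + 1) := by
        rw [sum_const, smul_eq_mul, pow_succ, mul_comm]
        exact Nat.mul_le_mul_left _ (hD x)

/-- A walk through `p` can be extended by a detour `p, q, p`. -/
lemma exists_detour {nb : α → Finset α} (hsymm : ∀ p q, q ∈ nb p → p ∈ nb q) {k : ℕ} {x : α}
    {l : List α} (hl : l ∈ tours nb k x) {p q : α} (hp : p ∈ l) (hq : q ∈ nb p) :
    ∃ l' ∈ tours nb (k + 2) x, l'.toFinset = insert q l.toFinset := by
  induction k generalizing x l with
  | zero =>
    simp only [tours, mem_singleton] at hl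
    subst hl
    obtain rfl : p = x := by simpa using hp
    refine ⟨[p, q, p], ?_, by ext; simp⟩
    simp only [tours, mem_biUnion, mem_image, mem_singleton]
    exact ⟨q, hq, [q, p], ⟨p, hsymm _ _ hq, [p], rfl, rfl⟩, rfl⟩
  | succ k ih =>
    by_cases hpx : p = x
    · subst hpx
      refine ⟨p :: q :: l, ?_, ?_⟩
      · rw [tours, mem_biUnion]
        refine ⟨q, hq, mem_image.2 ⟨q :: l, ?_, rfl⟩⟩
        rw [tours, mem_biUnion]
        exact ⟨p, hsymm _ _ hq, mem_image.2 ⟨l, hl, rfl⟩⟩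
      · ext a
        simp only [List.toFinset_cons, mem_insert, List.mem_toFinset]
        constructor
        · rintro (rfl | h | h)
          exacts [Or.inr hp, Or.inl h, Or.inr h]
        · tauto
    · rw [tours, mem_biUnion] at hl
      obtain ⟨y, hy, hl⟩ := hl
      obtain ⟨l₀, hl₀, rfl⟩ := mem_image.1 hl
      obtain ⟨l', hl', he⟩ := ih hl₀ (by simpa [hpx] using hp)
      refine ⟨x :: l', ?_, ?_⟩
      · rw [show k + 1 + 2 = (k + 2) + 1 by ring, tours, mem_biUnion]
        exact ⟨y, hy, mem_image.2 ⟨l', hl', rfl⟩⟩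
      · rw [List.toFinset_cons, he, List.toFinset_cons, Finset.insert_comm]

/-- A linked set is covered by a walk of twice its size: it grows one element at a time, each
new element costing a detour. -/
lemma IsLinked.exists_tour {nb : α → Finset α} (hsymm : ∀ p q, q ∈ nb p → p ∈ nb q) {x : α}
    {K : Finset α} (hK : IsLinked nb x K) :
    ∃ l ∈ tours nb (2 * (K.card - 1)) x, l.toFinset = K := by
  have hne : (K.powerset.filter fun K' : Finset α =>
      x ∈ K' ∧ K' ∈ (tours nb (2 * (K'.card - 1)) x).image List.toFinset).Nonempty := by
    refine ⟨{x}, ?_⟩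
    rw [mem_filter, mem_powerset, singleton_subset_iff]
    exact ⟨hK.1, mem_singleton_self x, mem_image.2 ⟨[x], by simp [tours], by simp⟩⟩
  obtain ⟨K', hK', hmax⟩ := exists_max_image _ card hne
  rw [mem_filter, mem_powerset, mem_image] at hK'
  obtain ⟨hsub, hx, l, hl, hlK⟩ := hK'
  by_cases heq : K' = K
  · exact heq ▸ ⟨l, hl, hlK⟩
  obtain ⟨p, hp, q, hqK, hqK', hq⟩ := hK.2 K' hsub hx heq
  obtain ⟨l', hl', he⟩ := exists_detour hsymm hl (by rw [← hlK] at hp; simpa using hp) hq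
  have hcard := card_insert_of_notMem hqK'
  have hpos : 0 < K'.card := card_pos.2 ⟨x, hx⟩
  have := hmax (insert q K') (by
    rw [mem_filter, mem_powerset, mem_image]
    refine ⟨insert_subset hqK hsub, mem_insert_of_mem hx, l', ?_, by rw [he, hlK]⟩
    rw [hcard]
    convert hl' using 2
    omega)
  omega

/-- There are at most `D ^ (2 * N)` sets of size `N` linked from a given point, if each point has
at most `D` neighbours. -/
lemma exists_linked_family {nb : α → Finset α} (hsymm : ∀ p q, q ∈ nb p → p ∈ nb q) {D : ℕ}
    (hD : ∀ x, (nb x).card ≤ D) (hD1 : 1 ≤ D) (x : α) (N : ℕ) :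
    ∃ 𝒦 : Finset (Finset α), 𝒦.card ≤ D ^ (2 * N) ∧
      ∀ K, IsLinked nb x K → K.card = N → K ∈ 𝒦 := by
  refine ⟨(tours nb (2 * (N - 1)) x).image List.toFinset, ?_, fun K hK hN => ?_⟩
  · exact card_image_le.trans ((card_tours_le nb D hD _ x).trans
      (Nat.pow_le_pow_right hD1 (by omega)))
  · obtain ⟨l, hl, he⟩ := hK.exists_tour hsymm
    exact mem_image.2 ⟨l, hN ▸ hl, he⟩

end Linked

/-! ### Distance balls -/

section Balls

variable {V : Type*} [Fintype V] [DecidableEq V] {G : SimpleGraph V} [DecidableRel G.Adj]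

lemma card_dist_le {d : ℕ} (hreg : G.IsRegularOfDegree d) (hconn : G.Connected) (v : V) (k : ℕ) :
    (univ.filter fun u => G.dist v u ≤ k).card ≤ (d + 1) ^ k := by
  induction k with
  | zero =>
    have : (univ.filter fun u => G.dist v u ≤ 0) ⊆ {v} := by
      intro u hu
      have h0 : G.dist v u = 0 := by simpa using hu
      rw [mem_singleton]
      exact (hconn.dist_eq_zero_iff.1 h0).symm
    simpa using card_le_card this
  | succ k ih =>
    have hsub : (univ.filter fun u => G.dist v u ≤ k + 1) ⊆
        (univ.filter fun u => G.dist v u ≤ k).biUnion fun w => insert w (G.neighborFinset w) := by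
      intro u hu
      have hu : G.dist v u ≤ k + 1 := by simpa using hu
      rw [mem_biUnion]
      obtain ⟨p, hp⟩ := hconn.exists_walk_length_eq_dist u v
      cases p with
      | nil => exact ⟨v, by simp, by simp⟩
      | @cons _ w _ hadj q =>
        refine ⟨w, ?_, by simp [hadj.symm]⟩
        have h1 := SimpleGraph.dist_le q
        rw [SimpleGraph.Walk.length_cons, SimpleGraph.dist_comm] at hp
        rw [SimpleGraph.dist_comm] at h1
        simp only [mem_filter, mem_univ, true_and]
        omega
    calc _ ≤ _ := card_le_card hsub
      _ ≤ ∑ w ∈ univ.filter (fun u => G.dist v u ≤ k), (insert w (G.neighborFinset w)).card :=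
        card_biUnion_le
      _ ≤ ∑ w ∈ univ.filter (fun u => G.dist v u ≤ k), (d + 1) := by
        refine sum_le_sum fun w _ => (card_insert_le _ _).trans ?_
        rw [card_neighborFinset_of_regular hreg]
      _ ≤ (d + 1) ^ (k + 1) := by
        rw [sum_const, smul_eq_mul, pow_succ]
        exact Nat.mul_le_mul_right _ ih

variable (G)

/-- Two labelled vertices `(y, j, b)` are close if the vertices are at distance at most `7` and
the levels `j` differ by at most one; the signs `b` are arbitrary. -/
noncomputable def closeTo (p : V × ℕ × Bool) : Finset (V × ℕ × Bool) :=
  (univ.filter fun u => G.dist p.1 u ≤ 7) ×ˢ (Icc (p.2.1 - 1) (p.2.1 + 1) ×ˢ univ)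

variable {G}

lemma mem_closeTo {p q : V × ℕ × Bool} :
    q ∈ closeTo G p ↔ G.dist p.1 q.1 ≤ 7 ∧ q.2.1 ≤ p.2.1 + 1 ∧ p.2.1 ≤ q.2.1 + 1 := by
  simp only [closeTo, mem_product, mem_filter, mem_univ, true_and, mem_Icc, and_true]
  omega

lemma closeTo_symm (p q : V × ℕ × Bool) (h : q ∈ closeTo G p) : p ∈ closeTo G q := by
  rw [mem_closeTo] at h ⊢
  rw [SimpleGraph.dist_comm]
  tauto

lemma card_closeTo_le {d : ℕ} (hreg : G.IsRegularOfDegree d) (hconn : G.Connected)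
    (p : V × ℕ × Bool) : (closeTo G p).card ≤ 6 * (d + 1) ^ 7 := by
  rw [closeTo, card_product, card_product, Nat.card_Icc, card_univ, Fintype.card_bool]
  have := card_dist_le hreg hconn p.1 7
  calc _ ≤ (d + 1) ^ 7 * (3 * 2) := Nat.mul_le_mul this (by omega)
    _ = _ := by ring

end Balls

end FlatLipschitz

/-! ### Certificates of an excursion -/

namespace FlatLipschitz

open Finset

section Certificates

variable {V : Type*} [Fintype V] [DecidableEq V] (G : SimpleGraph V) [DecidableRel G.Adj]

/-- The function `g` itself, or its reflection `M - g`, which exchanges excursions above the bulk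
`[0, M]` with excursions below it. -/
def side (M : ℕ) (b : Bool) (g : V → ℤ) (v : V) : ℤ := if b then g v else M - g v

/-- The vertices recorded in `K` at level `j` on side `b`. -/
def slice (K : Finset (V × ℕ × Bool)) (b : Bool) (j : ℕ) : Finset V :=
  univ.filter fun y => (y, j, b) ∈ K

/-- The vertices adjacent to a recorded vertex of level `j` on side `b`. -/
def front (K : Finset (V × ℕ × Bool)) (b : Bool) (j : ℕ) : Finset V := nbhd G (slice K b j)

/-- The container, computed from the record `(K, Z)`, for the vertices of the excursion which are
more than `j` beyond the bulk on side `b`. The auxiliary set `Z` removes vertices adjacent to it,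
and is only used above the bulk. -/
def hull (d : ℕ) (K : Finset (V × ℕ × Bool)) (Z : Finset V) (b : Bool) (j : ℕ) : Finset V :=
  core G d (front G K b j) \ (if b then nbhd G Z else ∅)

/-- The set on which the values of the function are to be resampled. -/
def region (d B : ℕ) (K : Finset (V × ℕ × Bool)) (Z : Finset V) : Finset V :=
  univ.filter fun u => ∃ b : Bool, ∃ j ∈ range B, u ∈ front G K b j ∨ u ∈ hull G d K Z b j

/-- The total size of the fronts of a record, over both sides and all levels below `B`. -/
def weight (B : ℕ) (K : Finset (V × ℕ × Bool)) : ℕ :=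
  ∑ b : Bool, ∑ j ∈ range B, (front G K b j).card

/-- The record `(K, Z)` certifies an excursion of `g` out of the bulk `[0, M]` at the vertex `v`:
it is cheap to describe (`card_le`, `aux`, `linked`), it constrains `g` on `region` and makes it
resamplable there (`front_lt`, `hull_of_lt`, `boundary`), and its weight is bounded below in terms
of the height of the excursion (`linear`, `growth`). -/
structure IsCertificate (d M B : ℕ) (ρ : ℝ) (g : V → ℤ) (v : V) (K : Finset (V × ℕ × Bool))
    (Z : Finset V) : Prop where
  level_lt : ∀ p ∈ K, p.2.1 < B
  card_le : d * K.card ≤ 100 * weight G B K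
  aux : Z = ∅ ∨ d * Z.card ≤ 100 * Fintype.card V ∧ 3 * Fintype.card V ≤ 5 * weight G B K
  linked : ∃ y b, G.dist v y ≤ 2 ∧ IsLinked (closeTo G) (y, 0, b) K
  hull_le : ∀ b j, 3 * (hull G d K Z b j).card ≤ 2 * (front G K b j).card
  front_lt : ∀ b j, ∀ u ∈ front G K b j, (j : ℤ) < side M b g u
  hull_of_lt : ∀ b (j : ℕ), ∀ u ∈ region G d B K Z, (M : ℤ) + j < side M b g u →
    u ∈ hull G d K Z b j
  boundary : ∀ u ∈ region G d B K Z, ∀ w ∉ region G d B K Z, G.Adj u w → 0 ≤ g w ∧ g w ≤ M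
  linear : ∀ b, 99 * (d : ℤ) * (side M b g v - M) ≤ 100 * weight G B K
  growth : ∀ b (t : ℕ), 2 * (M : ℤ) + t * M ≤ side M b g v → (M : ℝ) * ρ ^ t ≤ weight G B K

variable {G}

lemma mem_slice {K : Finset (V × ℕ × Bool)} {b : Bool} {j : ℕ} {y : V} :
    y ∈ slice K b j ↔ (y, j, b) ∈ K := by
  simp [slice]

lemma side_sub_le {M : ℕ} {g : V → ℤ} (hg : ∀ u v, G.Adj u v → |g u - g v| ≤ (M : ℤ)) (b : Bool)
    {u v : V} (h : G.Adj u v) : side M b g u ≤ side M b g v + M := by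
  have := abs_le.1 (hg u v h)
  cases b <;> simp only [side] <;> norm_num <;> omega

/-- The recorded approximations of the superlevel sets of a component `A` are linked. -/
lemma isLinked_of_isApprox (hconn : G.Connected) {A : Finset V}
    {X Y : Bool → ℕ → Finset V} {K : Finset (V × ℕ × Bool)} {v y₀ : V} {b₀ : Bool}
    (hK : ∀ y j b, (y, j, b) ∈ K ↔ y ∈ Y b j) (hYX : ∀ b j, Y b j ⊆ X b j)
    (hanti : ∀ b j, X b (j + 1) ⊆ X b j) (hX0 : ∀ b, X b 0 ⊆ A)
    (hAX : ∀ a ∈ A, ∃ b, a ∈ X b 0)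
    (hnear : ∀ b j, ∀ a ∈ X b j, ∃ y ∈ Y b j, G.dist a y ≤ 2)
    (hA : ∀ a ∈ A, Relation.ReflTransGen (fun x y => y ∈ A ∧ G.dist x y ≤ 3) v a)
    (hroot : y₀ ∈ Y b₀ 0) (hdist : G.dist v y₀ ≤ 2) :
    IsLinked (closeTo G) (y₀, 0, b₀) K := by
  refine ⟨(hK _ _ _).2 hroot, fun K' hsub hmem hne => ?_⟩
  by_contra hcon
  push Not at hcon
  have hstep : ∀ p ∈ K', ∀ q ∈ K, q ∈ closeTo G p → q ∈ K' := by
    intro p hp q hq hpq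
    by_contra hq'
    exact hcon p hp q hq hq' hpq
  have hcover : ∀ a ∈ A, ∃ y b, (y, 0, b) ∈ K' ∧ G.dist a y ≤ 2 := by
    intro a ha
    induction hA a ha with
    | refl => exact ⟨y₀, b₀, hmem, hdist⟩
    | @tail x z hx hz ih =>
      have hxA : ∃ y b, (y, 0, b) ∈ K' ∧ G.dist x y ≤ 2 := by
        rcases hx.cases_tail with rfl | ⟨w, -, hw⟩
        · exact ⟨y₀, b₀, hmem, hdist⟩
        · exact ih hw.1
      obtain ⟨y, b, hy, hxy⟩ := hxA
      obtain ⟨b', hb'⟩ := hAX z hz.1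
      obtain ⟨y', hy', hd'⟩ := hnear b' 0 z hb'
      refine ⟨y', b', hstep _ hy _ ((hK _ _ _).2 hy') (mem_closeTo.2 ⟨?_, by simp, by simp⟩), hd'⟩
      have h1 := hconn.dist_triangle (u := y) (v := x) (w := y')
      have h2 := hconn.dist_triangle (u := x) (v := z) (w := y')
      have h3 : G.dist y x ≤ 2 := by rw [SimpleGraph.dist_comm]; exact hxy
      have h4 := hz.2
      change G.dist y y' ≤ 7
      omega
  have hall : ∀ j y b, (y, j, b) ∈ K → (y, j, b) ∈ K' := by
    intro j
    induction j with
    | zero =>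
      intro y b hy
      obtain ⟨y', b', hy', hd'⟩ := hcover y (hX0 b (hYX b 0 ((hK _ _ _).1 hy)))
      refine hstep _ hy' _ hy (mem_closeTo.2 ⟨?_, by simp, by simp⟩)
      rw [SimpleGraph.dist_comm]
      exact hd'.trans (by norm_num)
    | succ j ih =>
      intro y b hy
      obtain ⟨y', hy', hd'⟩ := hnear b j y (hanti b j (hYX b _ ((hK _ _ _).1 hy)))
      refine hstep _ (ih y' b ((hK _ _ _).2 hy')) _ hy (mem_closeTo.2 ⟨?_, by simp, by simp; omega⟩)
      rw [SimpleGraph.dist_comm]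
      exact hd'.trans (by norm_num)
  exact hne (hsub.antisymm fun ⟨y, j, b⟩ h => hall j y b h)

end Certificates

section Existence

variable {V : Type*} [Fintype V] [DecidableEq V] {G : SimpleGraph V} [DecidableRel G.Adj]

lemma card_lt_zero_le {d M : ℕ} {lam : ℝ} (h : IsLambdaExpander G d lam) (hd : 0 < d)
    (hlam0 : 0 ≤ lam) (hlam : lam ≤ (d : ℝ) / 5) {g : V → ℤ}
    (hg : ∀ u v, G.Adj u v → |g u - g v| ≤ (M : ℤ)) (hc : IsCentred G d M g) :
    5 * (univ.filter fun u => g u < 0).card ≤ 2 * Fintype.card V := by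
  obtain ⟨Y, hY⟩ := exists_isApprox (G := G) d (univ.filter fun u => g u < 0)
  have h1 := hc.below Y (hY.subset.trans fun a ha => mem_lowSet.2 fun u hu => by
    have := abs_le.1 (hg a u hu)
    have h2 : g a < 0 := by simpa using ha
    omega) hY.sparse
  have h2 := three_mul_card_core_le h hd hlam0 hlam h1.le
  have h3 := card_le_card hY.subset_core
  omega

lemma card_gt_le {d M : ℕ} {g : V → ℤ} (hc : IsCentred G d M g) :
    5 * (univ.filter fun u => (M : ℤ) < g u).card ≤ 2 * Fintype.card V := by
  obtain ⟨Y, hY, -, hcard⟩ := hc.above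
  have hdisj : Disjoint (univ.filter fun u => (M : ℤ) < g u) (nbhd G Y) := by
    rw [disjoint_left]
    intro u hu hu'
    obtain ⟨y, hy, hyu⟩ := mem_nbhd.1 hu'
    have := mem_lowSet.1 (hY hy) u hyu
    have h2 : (M : ℤ) < g u := by simpa using hu
    omega
  have := card_le_univ ((univ.filter fun u => (M : ℤ) < g u) ∪ nbhd G Y)
  rw [card_union_of_disjoint hdisj] at this
  omega

/-- A centred function is in the bulk on at least one fifth of the vertices. -/
lemma card_bulk_ge {d M : ℕ} {lam : ℝ} (h : IsLambdaExpander G d lam) (hd : 0 < d)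
    (hlam0 : 0 ≤ lam) (hlam : lam ≤ (d : ℝ) / 5) {g : V → ℤ}
    (hg : ∀ u v, G.Adj u v → |g u - g v| ≤ (M : ℤ)) (hc : IsCentred G d M g) :
    Fintype.card V ≤ 5 * (univ.filter fun u => 0 ≤ g u ∧ g u ≤ M).card := by
  have h1 := card_lt_zero_le h hd hlam0 hlam hg hc
  have h2 := card_gt_le hc
  have h3 : (univ : Finset V) ⊆ (univ.filter fun u => 0 ≤ g u ∧ g u ≤ (M : ℤ)) ∪
      ((univ.filter fun u => g u < 0) ∪ (univ.filter fun u => (M : ℤ) < g u)) := by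
    intro u _
    simp only [mem_union, mem_filter, mem_univ, true_and]
    omega
  have h4 := (card_le_card h3).trans ((card_union_le _ _).trans
    (Nat.add_le_add_left (card_union_le _ _) _))
  rw [card_univ] at h4
  omega

/-- Every vertex outside the bulk of a centred Lipschitz function has a certificate. -/
theorem exists_isCertificate {d M B : ℕ} {lam : ℝ} (h : IsLambdaExpander G d lam)
    (hconn : G.Connected) (hd : 0 < d) (hlam0 : 0 < lam) (hlam : lam ≤ (d : ℝ) / 5) {g : V → ℤ}
    (hg : ∀ u v, G.Adj u v → |g u - g v| ≤ (M : ℤ)) (hc : IsCentred G d M g)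
    (hB : ∀ b u, side M b g u ≤ M + B) {v : V} (hv : ¬(0 ≤ g v ∧ g v ≤ M)) :
    ∃ K Z, IsCertificate G d M B ((39 * d / (100 * lam)) ^ 2) g v K Z := by
  classical
  have hreg := h.1
  -- the excursion of `v`: the vertices outside the bulk reached from `v` by steps of length at most `3`
  let A : Finset V := univ.filter fun a => Relation.ReflTransGen
    (fun x y => ¬(0 ≤ g y ∧ g y ≤ M) ∧ G.dist x y ≤ 3) v a
  have hAmem : ∀ a, a ∈ A ↔ Relation.ReflTransGen
    (fun x y => ¬(0 ≤ g y ∧ g y ≤ M) ∧ G.dist x y ≤ 3) v a := fun a => by simp [A]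
  have hvA : v ∈ A := (hAmem v).2 .refl
  have hAbad : ∀ a ∈ A, ¬(0 ≤ g a ∧ g a ≤ M) := by
    intro a ha
    rcases ((hAmem a).1 ha).cases_tail with rfl | ⟨w, -, hw⟩
    exacts [hv, hw.1]
  have hAclosed : ∀ a ∈ A, ∀ w, ¬(0 ≤ g w ∧ g w ≤ M) → G.dist a w ≤ 3 → w ∈ A :=
    fun a ha w hw hdist => (hAmem w).2 (((hAmem a).1 ha).tail ⟨hw, hdist⟩)
  have hAlink : ∀ a ∈ A, Relation.ReflTransGen (fun x y => y ∈ A ∧ G.dist x y ≤ 3) v a := by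
    intro a ha
    induction (hAmem a).1 ha with
    | refl => exact .refl
    | @tail x z hx hz ih =>
      exact (ih ((hAmem x).2 hx)).tail ⟨(hAmem z).2 (hx.tail hz), hz.2⟩
  have hside : ∀ u, ¬(0 ≤ g u ∧ g u ≤ M) ↔ ∃ b, (M : ℤ) < side M b g u := by
    intro u
    simp only [side, Bool.exists_bool]
    norm_num
    omega
  -- its superlevel sets on each side of the bulk; their approximations form the record
  let X : Bool → ℕ → Finset V := fun b j => A.filter fun a => (M : ℤ) + j < side M b g a
  have hXmem : ∀ b j a, a ∈ X b j ↔ a ∈ A ∧ (M : ℤ) + j < side M b g a := fun b j a => by simp [X]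
  choose Y hY using fun b j => exists_isApprox (G := G) d (X b j)
  have hYX : ∀ b j, Y b j ⊆ X b j := fun b j => (hY b j).subset
  have hYB : ∀ b j, B ≤ j → Y b j = ∅ := by
    intro b j hj
    refine subset_empty.1 fun y hy => ?_
    have h1 := ((hXmem b j y).1 (hYX b j hy)).2
    have h2 := hB b y
    omega
  let K : Finset (V × ℕ × Bool) :=
    (univ ×ˢ (range B ×ˢ univ)).filter fun p => p.1 ∈ Y p.2.2 p.2.1
  have hK : ∀ y j b, (y, j, b) ∈ K ↔ y ∈ Y b j := by
    intro y j b
    simp only [K, mem_filter, mem_product, mem_univ, true_and, and_true, mem_range]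
    refine ⟨fun h => h.2, fun h => ⟨?_, h⟩⟩
    by_contra hj
    rw [hYB b j (by omega)] at h
    simp at h
  have hslice : ∀ b j, slice K b j = Y b j := fun b j => by ext y; rw [mem_slice, hK]
  have hfront : ∀ b j, front G K b j = nbhd G (Y b j) := fun b j => by rw [front, hslice]
  have hXcore : ∀ b j, X b j ⊆ core G d (front G K b j) := fun b j => by
    rw [hfront]; exact (hY b j).subset_core
  have hfrontB : ∀ b j, B ≤ j → front G K b j = ∅ := fun b j hj => by
    rw [hfront, hYB b j hj, nbhd_empty]
  have hweight : ∀ b j, (front G K b j).card ≤ weight G B K := by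
    intro b j
    by_cases hj : j < B
    · exact (single_le_sum (f := fun j => (front G K b j).card) (fun _ _ => Nat.zero_le _)
        (mem_range.2 hj)).trans (single_le_sum
          (f := fun b => ∑ j ∈ range B, (front G K b j).card) (fun _ _ => Nat.zero_le _)
          (mem_univ b))
    · rw [hfrontB b j (by omega)]; simp
  -- the part of the record below the bulk is small because the function is centred
  have hlow : ∀ j, 5 * (front G K false j).card < 3 * Fintype.card V := by
    intro j
    rw [hfront]
    refine hc.below _ (fun y hy => mem_lowSet.2 fun u hu => ?_) (hY false j).sparse
    have h1 := ((hXmem _ _ _).1 (hYX _ _ hy)).2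
    have h2 := abs_le.1 (hg y u hu)
    simp only [side] at h1
    norm_num at h1
    omega
  -- expansion does not bound the core of a front with more than `3 / 5` of the vertices; in that case
  -- `Z` witnesses `IsCentred.above`, and its neighbourhood is cut out of the core
  obtain ⟨Z, hZlow, hZaux, hZcard⟩ : ∃ Z : Finset V, (∀ u ∈ nbhd G Z, g u ≤ M) ∧
      (Z = ∅ ∨ d * Z.card ≤ 100 * Fintype.card V ∧ 3 * Fintype.card V ≤ 5 * weight G B K) ∧
      ∀ j, 3 * Fintype.card V ≤ 5 * (front G K true j).card →
        3 * Fintype.card V ≤ 5 * (nbhd G Z).card := by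
    by_cases hbig : ∃ j, 3 * Fintype.card V ≤ 5 * (front G K true j).card
    · obtain ⟨j, hj⟩ := hbig
      obtain ⟨Z, hZ, hs, hcard⟩ := hc.above
      refine ⟨Z, fun u hu => ?_, Or.inr ⟨?_, ?_⟩, fun _ _ => hcard⟩
      · obtain ⟨y, hy, hyu⟩ := mem_nbhd.1 hu
        exact mem_lowSet.1 (hZ hy) u hyu
      · exact hs.trans (Nat.mul_le_mul_left _ (card_le_univ _))
      · exact hj.trans (Nat.mul_le_mul_left _ (hweight true j))
    · push Not at hbig
      exact ⟨∅, by simp [nbhd_empty], Or.inl rfl, fun j hj => absurd hj (not_le.2 (hbig j))⟩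
  have hXhull : ∀ b j, X b j ⊆ hull G d K Z b j := by
    intro b j a ha
    rw [hull, mem_sdiff]
    refine ⟨hXcore b j ha, ?_⟩
    cases b with
    | false => simp
    | true =>
      intro haZ
      have h1 := hZlow a (by simpa using haZ)
      have h2 := ((hXmem _ _ _).1 ha).2
      simp only [side, if_true] at h2
      omega
  have hhull : ∀ b j, 3 * (hull G d K Z b j).card ≤ 2 * (front G K b j).card := by
    intro b j
    by_cases hsmall : 5 * (front G K b j).card ≤ 3 * Fintype.card V
    · exact (Nat.mul_le_mul_left _ (card_le_card sdiff_subset)).trans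
        (three_mul_card_core_le h hd hlam0.le hlam hsmall)
    · cases b with
      | false => exact absurd (hlow j).le hsmall
      | true =>
        have h1 := hZcard j (by omega)
        have h2 : hull G d K Z true j ⊆ univ \ nbhd G Z := by
          rw [hull, if_pos rfl]
          exact sdiff_subset_sdiff (subset_univ _) subset_rfl
        have h3 := card_le_card h2
        rw [card_univ_sdiff] at h3
        omega
  have hfrontA : ∀ b j, ∀ u ∈ front G K b j, ∃ a ∈ X b j, G.Adj a u := by
    intro b j u hu
    rw [hfront] at hu
    obtain ⟨y, hy, hyu⟩ := mem_nbhd.1 hu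
    exact ⟨y, hYX b j hy, hyu⟩
  have hdist1 : ∀ {x y : V}, G.Adj x y → G.dist x y = 1 :=
    fun hxy => SimpleGraph.dist_eq_one_iff_adj.2 hxy
  have hregion : ∀ u ∈ region G d B K Z, ∃ a ∈ A, G.dist a u ≤ 2 := by
    intro u hu
    simp only [region, mem_filter, mem_univ, true_and] at hu
    obtain ⟨b, j, -, hu | hu⟩ := hu
    · obtain ⟨a, ha, hau⟩ := hfrontA b j u hu
      exact ⟨a, ((hXmem _ _ _).1 ha).1, by rw [hdist1 hau]; norm_num⟩
    · obtain ⟨w, hw, huw⟩ := exists_adj_of_mem_core hreg hd (mem_sdiff.1 hu).1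
      obtain ⟨a, ha, haw⟩ := hfrontA b j w hw
      refine ⟨a, ((hXmem _ _ _).1 ha).1, ?_⟩
      have := hconn.dist_triangle (u := a) (v := w) (w := u)
      rw [hdist1 haw, hdist1 huw.symm] at this
      exact this
  have hAregion : A ⊆ region G d B K Z := by
    intro a ha
    obtain ⟨b, hb⟩ := (hside a).1 (hAbad a ha)
    have h0B : 0 < B := by have := hB b a; omega
    simp only [region, mem_filter, mem_univ, true_and, mem_range]
    exact ⟨b, 0, h0B, Or.inr (hXhull b 0 ((hXmem _ _ _).2 ⟨ha, by simpa using hb⟩))⟩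
  have hnear : ∀ b j, ∀ a ∈ X b j, ∃ y ∈ Y b j, G.dist a y ≤ 2 := by
    intro b j a ha
    obtain ⟨w, hw, haw⟩ := exists_adj_of_mem_core hreg hd (hXcore b j ha)
    rw [hfront] at hw
    obtain ⟨y, hy, hyw⟩ := mem_nbhd.1 hw
    refine ⟨y, hy, ?_⟩
    have := hconn.dist_triangle (u := a) (v := w) (w := y)
    rw [hdist1 haw, hdist1 hyw.symm] at this
    exact this
  have hXhalf : ∀ b j, 3 * (X b j).card ≤ 2 * (front G K b j).card := fun b j =>
    (Nat.mul_le_mul_left _ (card_le_card (hXhull b j))).trans (hhull b j)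
  have hlower : ∀ b j, ∀ u ∈ front G K b j, (j : ℤ) < side M b g u := by
    intro b j u hu
    obtain ⟨a, ha, hau⟩ := hfrontA b j u hu
    have h1 := side_sub_le hg b hau
    have h2 := ((hXmem _ _ _).1 ha).2
    omega
  refine ⟨K, Z, ?_, ?_, hZaux, ?_, hhull, hlower, ?_, ?_, ?_, ?_⟩
  · rintro p hp
    have := (mem_filter.1 hp).1
    simp only [mem_product, mem_univ, true_and, and_true, mem_range] at this
    exact this
  · have hcardK : K.card = ∑ b : Bool, ∑ j ∈ range B, (Y b j).card := by
      rw [card_filter, sum_product, sum_comm, sum_product_right]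
      refine sum_congr rfl fun b _ => sum_congr rfl fun j _ => ?_
      rw [← card_filter]
      congr 1
      ext y
      simp
    rw [hcardK, weight, mul_sum, mul_sum]
    refine sum_le_sum fun b _ => ?_
    rw [mul_sum, mul_sum]
    refine sum_le_sum fun j _ => ?_
    rw [hfront]
    exact (hY b j).sparse
  · obtain ⟨b, hb⟩ := (hside v).1 hv
    obtain ⟨y, hy, hvy⟩ := hnear b 0 v ((hXmem _ _ _).2 ⟨hvA, by simpa using hb⟩)
    refine ⟨y, b, hvy, isLinked_of_isApprox hconn hK hYX (fun b j a ha => ?_)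
      (fun b => filter_subset _ _) (fun a ha => ?_) hnear hAlink hy hvy⟩
    · rw [hXmem] at ha ⊢
      refine ⟨ha.1, ?_⟩
      have := ha.2
      push_cast at this
      omega
    · obtain ⟨b', hb'⟩ := (hside a).1 (hAbad a ha)
      exact ⟨b', (hXmem _ _ _).2 ⟨ha, by simpa using hb'⟩⟩
  · intro b j u hu hlt
    obtain ⟨a, ha, hau⟩ := hregion u hu
    have hbad : ¬(0 ≤ g u ∧ g u ≤ M) := (hside u).2 ⟨b, by omega⟩
    exact hXhull b j ((hXmem _ _ _).2 ⟨hAclosed a ha u hbad (by omega), hlt⟩)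
  · intro u hu w hw huw
    by_contra hbad
    obtain ⟨a, ha, hau⟩ := hregion u hu
    refine hw (hAregion (hAclosed a ha w hbad ?_))
    have := hconn.dist_triangle (u := a) (v := u) (w := w)
    rw [hdist1 huw] at this
    omega
  · intro b
    by_cases hneg : side M b g v - M ≤ 0
    · have : 99 * (d : ℤ) * (side M b g v - M) ≤ 0 :=
        mul_nonpos_of_nonneg_of_nonpos (by positivity) hneg
      have h0 : (0 : ℤ) ≤ 100 * (weight G B K : ℤ) := by positivity
      omega
    · obtain ⟨m, hm⟩ := Int.eq_ofNat_of_zero_le (a := side M b g v - M) (by omega)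
      have hmB : m ≤ B := by have := hB b v; omega
      have h1 : ∀ j ∈ range m, 99 * d ≤ 100 * (front G K b j).card := by
        intro j hj
        have hvX : v ∈ X b j := (hXmem _ _ _).2 ⟨hvA, by have := mem_range.1 hj; omega⟩
        exact (le_card_inter_of_mem_core hreg (hXcore b j hvX)).trans
          (Nat.mul_le_mul_left _ (card_le_card inter_subset_right))
      have h2 : 99 * d * m ≤ 100 * weight G B K := by
        calc 99 * d * m = ∑ j ∈ range m, 99 * d := by
              rw [sum_const, card_range, smul_eq_mul, mul_comm]
          _ ≤ ∑ j ∈ range m, 100 * (front G K b j).card := sum_le_sum h1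
          _ = 100 * ∑ j ∈ range m, (front G K b j).card := by rw [mul_sum]
          _ ≤ 100 * weight G B K := by
            refine Nat.mul_le_mul_left _ ((sum_le_sum_of_subset (range_mono hmB)).trans ?_)
            exact single_le_sum (f := fun b => ∑ j ∈ range B, (front G K b j).card)
              (fun _ _ => Nat.zero_le _) (mem_univ b)
      rw [hm]
      exact_mod_cast h2
  · -- each step of height `M` towards the bulk multiplies the superlevel sets by `ρ`
    set ρ : ℝ := (39 * d / (100 * lam)) ^ 2 with hρ
    have hρ0 : 0 ≤ ρ := by positivity
    intro b t ht
    have hX0small : ∀ j, 5 * (X b j).card ≤ 2 * Fintype.card V := by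
      intro j
      cases b with
      | false =>
        refine (Nat.mul_le_mul_left _ (card_le_card fun a ha => ?_)).trans
          (card_lt_zero_le h hd hlam0.le hlam hg hc)
        have := ((hXmem _ _ _).1 ha).2
        simp only [side] at this
        norm_num at this
        simp only [mem_filter, mem_univ, true_and]
        omega
      | true =>
        refine (Nat.mul_le_mul_left _ (card_le_card fun a ha => ?_)).trans (card_gt_le hc)
        have := ((hXmem _ _ _).1 ha).2
        simp only [side, if_true] at this
        simp only [mem_filter, mem_univ, true_and]
        omega
    have hfrontX : ∀ j, front G K b (M + j) ⊆ X b j := by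
      intro j u hu
      obtain ⟨a, ha, hau⟩ := hfrontA b _ u hu
      have h1 := hlower b _ u hu
      push_cast at h1
      refine (hXmem _ _ _).2 ⟨hAclosed a ((hXmem _ _ _).1 ha).1 u ((hside u).2 ⟨b, by omega⟩) ?_, h1⟩
      rw [hdist1 hau]; norm_num
    have hgrow : ∀ t j : ℕ, (M : ℤ) + j + t * M < side M b g v → ρ ^ t ≤ ((X b j).card : ℝ) := by
      intro t
      induction t with
      | zero =>
        intro j hj
        have : 0 < (X b j).card := card_pos.2 ⟨v, (hXmem _ _ _).2 ⟨hvA, by push_cast at hj; omega⟩⟩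
        rw [pow_zero]; exact_mod_cast this
      | succ t ih =>
        intro j hj
        have h1 := ih (M + j) (by push_cast at hj ⊢; linarith)
        have h2 : ((front G K b (M + j)).card : ℝ) ≤ (X b j).card :=
          by exact_mod_cast card_le_card (hfrontX j)
        have h3 := card_core_mul_le h (F := front G K b (M + j)) (by
          have := card_le_card (hfrontX j)
          have := hX0small j
          omega)
        have h4 : ((X b (M + j)).card : ℝ) ≤ (core G d (front G K b (M + j))).card := by
          exact_mod_cast card_le_card (hXcore b (M + j))
        have h5 : ρ * (core G d (front G K b (M + j))).card ≤ (front G K b (M + j)).card := by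
          have : ρ = (39 / 100 * (d : ℝ)) ^ 2 / lam ^ 2 := by
            rw [hρ, ← div_pow]; congr 1; field_simp
          rw [this, div_mul_eq_mul_div, div_le_iff₀ (by positivity)]
          linarith
        calc ρ ^ (t + 1) = ρ * ρ ^ t := by ring
          _ ≤ ρ * (core G d (front G K b (M + j))).card :=
            mul_le_mul_of_nonneg_left (h1.trans h4) hρ0
          _ ≤ _ := h5.trans h2
    have hMB : M ≤ B := by
      have := hB b v
      have h0 : (0 : ℤ) ≤ t * M := by positivity
      omega
    calc (M : ℝ) * ρ ^ t = ∑ j ∈ range M, ρ ^ t := by rw [sum_const, card_range, nsmul_eq_mul]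
      _ ≤ ∑ j ∈ range M, ((front G K b j).card : ℝ) := by
        refine sum_le_sum fun j hj => ?_
        have hjM := mem_range.1 hj
        have h1 := hgrow t j (by omega)
        have h2 : (3 : ℝ) * (X b j).card ≤ 2 * (front G K b j).card := by
          exact_mod_cast hXhalf b j
        have h3 : (0 : ℝ) ≤ (X b j).card := by positivity
        linarith
      _ ≤ weight G B K := by
        have : ∑ j ∈ range M, (front G K b j).card ≤ weight G B K :=
          (sum_le_sum_of_subset (range_mono hMB)).trans
            (single_le_sum (f := fun b => ∑ j ∈ range B, (front G K b j).card)
              (fun _ _ => Nat.zero_le _) (mem_univ b))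
        exact_mod_cast this

end Existence

end FlatLipschitz

/-! ### Resampling and the number of functions with a given certificate -/

namespace FlatLipschitz

open Finset

section Resampling

/-- If a region can be resampled freely with values in `[0, M]`, the number of functions is
controlled by the number of values they take at each vertex of the region. -/
lemma card_mul_pow_le {V : Type*} [Fintype V] [DecidableEq V] (M : ℕ) (R : Finset V)
    (𝓕 T : Finset (V → ℤ))
    (hT : ∀ f ∈ 𝓕, ∀ ξ : V → ℤ, (∀ u ∈ R, 0 ≤ ξ u ∧ ξ u ≤ M) →
      (fun u => if u ∈ R then ξ u else f u) ∈ T) :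
    𝓕.card * (M + 1) ^ R.card ≤ T.card * ∏ u ∈ R, (𝓕.image fun f => f u).card := by
  let P : Finset (V → ℤ) := Fintype.piFinset fun u => if u ∈ R then Icc 0 (M : ℤ) else {0}
  let Q : Finset (V → ℤ) :=
    Fintype.piFinset fun u => if u ∈ R then 𝓕.image fun f => f u else {0}
  have hP : P.card = (M + 1) ^ R.card := by
    rw [Fintype.card_piFinset, ← prod_const]
    have : ∀ u, (if u ∈ R then Icc 0 (M : ℤ) else {0}).card = if u ∈ R then M + 1 else 1 := by
      intro u
      split_ifs
      · rw [Int.card_Icc]; omega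
      · simp
    simp_rw [this]
    rw [prod_ite_mem, univ_inter]
  have hQ : Q.card = ∏ u ∈ R, (𝓕.image fun f => f u).card := by
    rw [Fintype.card_piFinset]
    have : ∀ u, (if u ∈ R then 𝓕.image fun f => f u else {0}).card
        = if u ∈ R then (𝓕.image fun f => f u).card else 1 := by
      intro u
      split_ifs <;> simp
    simp_rw [this]
    rw [prod_ite_mem, univ_inter]
  rw [← hP, ← hQ, ← card_product, ← card_product]
  refine card_le_card_of_injOn
    (fun p => (fun u => if u ∈ R then p.2 u else p.1 u, fun u => if u ∈ R then p.1 u else 0))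
    ?_ ?_
  · rintro ⟨f, ξ⟩ hp
    obtain ⟨hf, hξ⟩ := mem_product.1 hp
    have hξ' := Fintype.mem_piFinset.1 hξ
    refine mem_product.2 ⟨hT f hf ξ fun u hu => ?_, Fintype.mem_piFinset.2 fun u => ?_⟩
    · have := hξ' u
      rw [if_pos hu, mem_Icc] at this
      exact this
    · dsimp only
      split_ifs
      · exact mem_image_of_mem _ hf
      · simp
  · rintro ⟨f, ξ⟩ hp ⟨f', ξ'⟩ hp' heq
    have h1 := Fintype.mem_piFinset.1 (mem_product.1 hp).2
    have h2 := Fintype.mem_piFinset.1 (mem_product.1 hp').2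
    simp only [Prod.mk.injEq] at heq
    have hkey : ∀ u, f u = f' u ∧ ξ u = ξ' u := by
      intro u
      have e1 := congrFun heq.1 u
      have e2 := congrFun heq.2 u
      have e3 := h1 u
      have e4 := h2 u
      by_cases hu : u ∈ R
      · simp only [hu, if_true] at e1 e2
        exact ⟨e2, e1⟩
      · simp only [hu, if_false, mem_singleton] at e1 e3 e4
        exact ⟨e1, by rw [e3, e4]⟩
    exact Prod.ext (funext fun u => (hkey u).1) (funext fun u => (hkey u).2)

/-- The constraints from levels on both sides confine a value to an interval. A set `P b` of `p`
strict lower bounds forces a height at least `p`, and a height above `M + q` needs more than `q`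
levels in `Q b`. -/
lemma card_values_le {M : ℕ} {X : Finset ℤ} (hne : X.Nonempty) {P Q : Bool → Finset ℕ}
    (hP : ∀ x ∈ X, ∀ b, ∀ j ∈ P b, (j : ℤ) < if b then x else M - x)
    (hQ : ∀ x ∈ X, ∀ b, ∀ j : ℕ, (M : ℤ) + j < (if b then x else M - x) → j ∈ Q b) :
    (X.card : ℤ) ≤ M + 1 + ∑ b : Bool, (((Q b).card : ℤ) - (P b).card) := by
  have hP' : ∀ x ∈ X, ∀ b, (P b).Nonempty → ((P b).card : ℤ) ≤ if b then x else M - x := by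
    intro x hx b ⟨i, hi⟩
    have hpos := hP x hx b i hi
    set s : ℤ := if b then x else M - x
    have : P b ⊆ range s.toNat := fun j hj => by
      have := hP x hx b j hj
      rw [mem_range]
      omega
    have := card_le_card this
    rw [card_range] at this
    omega
  have hQ' : ∀ x ∈ X, ∀ b, (if b then x else M - x) ≤ (M : ℤ) + (Q b).card := by
    intro x hx b
    have h := hQ x hx b
    set s : ℤ := if b then x else M - x
    have : range (s - M).toNat ⊆ Q b := fun j hj => h j (by rw [mem_range] at hj; omega)
    have := card_le_card this
    rw [card_range] at this
    omega
  let lo : ℤ := if (P true).Nonempty then (P true).card else -((Q false).card : ℤ)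
  let hi : ℤ := if (P false).Nonempty then M - (P false).card else M + (Q true).card
  have hsub : X ⊆ Icc lo hi := by
    intro x hx
    have a1 := hP' x hx true
    have a2 := hP' x hx false
    have a3 := hQ' x hx true
    have a4 := hQ' x hx false
    simp only [if_true, Bool.false_eq_true, if_false] at a1 a2 a3 a4
    rw [mem_Icc]
    constructor
    · by_cases h : (P true).Nonempty
      · simp only [lo, if_pos h]; exact a1 h
      · simp only [lo, if_neg h]; linarith
    · by_cases h : (P false).Nonempty
      · simp only [hi, if_pos h]; have := a2 h; linarith
      · simp only [hi, if_neg h]; exact a3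
  have hcard := card_le_card hsub
  rw [Int.card_Icc] at hcard
  have hpos := card_pos.2 hne
  rw [Fintype.sum_bool]
  have hlo : -lo ≤ (Q false).card - (P true).card := by
    by_cases h : (P true).Nonempty
    · simp only [lo, if_pos h]; omega
    · simp only [lo, if_neg h, not_nonempty_iff_eq_empty.1 h, card_empty]; omega
  have hhi : hi ≤ M + (Q true).card - (P false).card := by
    by_cases h : (P false).Nonempty
    · simp only [hi, if_pos h]; omega
    · simp only [hi, if_neg h, not_nonempty_iff_eq_empty.1 h, card_empty]; omega
  omega

variable {V : Type*} [Fintype V] [DecidableEq V] {G : SimpleGraph V} [DecidableRel G.Adj]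

/-- The number of functions with a given certificate is exponentially small in its weight. -/
lemma card_certified_le {d M B : ℕ} {ρ : ℝ} {v : V} {K : Finset (V × ℕ × Bool)} {Z : Finset V}
    {𝓕 T : Finset (V → ℤ)}
    (hT : ∀ g, g ∈ T ↔ (∀ u w, G.Adj u w → |g u - g w| ≤ (M : ℤ)) ∧
      Fintype.card V ≤ 5 * (univ.filter fun u => 0 ≤ g u ∧ g u ≤ M).card)
    (h𝓕T : 𝓕 ⊆ T) (hcert : ∀ g ∈ 𝓕, IsCertificate G d M B ρ g v K Z) :
    (𝓕.card : ℝ) ≤ T.card * Real.exp (-(weight G B K / (3 * (M + 1)))) := by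
  rcases 𝓕.eq_empty_or_nonempty with rfl | ⟨g₀, hg₀⟩
  · simp only [card_empty, Nat.cast_zero]; positivity
  set R := region G d B K Z with hR
  have hflip := card_mul_pow_le M R 𝓕 T fun g hg ξ hξ => by
    obtain ⟨hlip, hbulk⟩ := (hT g).1 (h𝓕T hg)
    refine (hT _).2 ⟨fun u w huw => ?_, hbulk.trans (Nat.mul_le_mul_left _ (card_le_card ?_))⟩
    · have hbd := (hcert g hg).boundary
      split_ifs with hu hw hw
      · have := hξ u hu; have := hξ w hw; rw [abs_le]; omega
      · have := hξ u hu; have := hbd u hu w hw huw; rw [abs_le]; omega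
      · have := hξ w hw; have := hbd w hw u hu huw.symm; rw [abs_le]; omega
      · exact hlip u w huw
    · intro u hu
      simp only [mem_filter, mem_univ, true_and] at hu ⊢
      split_ifs with h
      · exact hξ u h
      · exact hu
  have hempty : ∀ b j, B ≤ j → front G K b j = ∅ := by
    intro b j hj
    have : slice K b j = ∅ := by
      refine subset_empty.1 fun y hy => ?_
      have h1 : j < B := (hcert g₀ hg₀).level_lt _ (mem_slice.1 hy)
      omega
    rw [front, this, nbhd_empty]
  have hlevel : ∀ b j u, u ∈ hull G d K Z b j → j < B := by
    intro b j u hu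
    by_contra hj
    have h1 := (hcert g₀ hg₀).hull_le b j
    rw [hempty b j (by omega), card_empty] at h1
    have := card_pos.2 ⟨u, hu⟩
    omega
  -- at each vertex, hulls are levels that a value may exceed and fronts are levels it has to exceed
  have hval : ∀ u ∈ R, ((𝓕.image fun f => f u).card : ℤ) ≤ M + 1 + ∑ b : Bool,
      ((((range B).filter fun j => u ∈ hull G d K Z b j).card : ℤ)
        - ((range B).filter fun j => u ∈ front G K b j).card) := by
    intro u hu
    refine card_values_le ⟨g₀ u, mem_image_of_mem (fun f : V → ℤ => f u) hg₀⟩ ?_ ?_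
    · intro x hx b j hj
      obtain ⟨g, hg, rfl⟩ := mem_image.1 hx
      exact (hcert g hg).front_lt b j u (mem_filter.1 hj).2
    · intro x hx b j hj
      obtain ⟨g, hg, rfl⟩ := mem_image.1 hx
      have := (hcert g hg).hull_of_lt b j u hu hj
      exact mem_filter.2 ⟨mem_range.2 (hlevel b j u this), this⟩
  have hcount : ∀ E : ℕ → Finset V, (∀ j < B, E j ⊆ R) →
      ∑ u ∈ R, (((range B).filter fun j => u ∈ E j).card : ℤ) = ∑ j ∈ range B, ((E j).card : ℤ) := by
    intro E hE
    simp_rw [card_filter]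
    push_cast
    rw [sum_comm]
    refine sum_congr rfl fun j hj => ?_
    rw [← sum_filter, sum_const, filter_mem_eq_inter,
      inter_eq_right.2 (hE j (mem_range.1 hj))]
    simp
  have hsum : ∑ u ∈ R, (((𝓕.image fun f => f u).card : ℤ) - (M + 1)) * 3 ≤ -(weight G B K : ℤ) := by
    calc ∑ u ∈ R, (((𝓕.image fun f => f u).card : ℤ) - (M + 1)) * 3
        ≤ ∑ u ∈ R, (∑ b : Bool,
          ((((range B).filter fun j => u ∈ hull G d K Z b j).card : ℤ)
            - ((range B).filter fun j => u ∈ front G K b j).card)) * 3 :=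
          sum_le_sum fun u hu => by have := hval u hu; linarith
      _ = ∑ b : Bool, ∑ j ∈ range B,
          (3 * ((hull G d K Z b j).card : ℤ) - 3 * (front G K b j).card) := by
          rw [← sum_mul, sum_comm, sum_mul]
          refine sum_congr rfl fun b _ => ?_
          rw [sum_sub_distrib, hcount (hull G d K Z b), hcount (front G K b), sum_sub_distrib,
            ← mul_sum, ← mul_sum]
          · ring
          · intro j hj u hu
            exact mem_filter.2 ⟨mem_univ _, b, j, mem_range.2 hj, Or.inl hu⟩
          · intro j hj u hu
            exact mem_filter.2 ⟨mem_univ _, b, j, mem_range.2 hj, Or.inr hu⟩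
      _ ≤ ∑ b : Bool, ∑ j ∈ range B, (-((front G K b j).card : ℤ)) := by
          refine sum_le_sum fun b _ => sum_le_sum fun j _ => ?_
          have := (hcert g₀ hg₀).hull_le b j
          omega
      _ = -(weight G B K : ℤ) := by
          rw [weight]; push_cast; simp only [sum_neg_distrib]
  have hμ : (0 : ℝ) < (M : ℝ) + 1 := by positivity
  -- `x / (M + 1) ≤ exp (x / (M + 1) - 1)` turns the product into the sum just bounded
  have hprod : ((∏ u ∈ R, (𝓕.image fun f => f u).card : ℕ) : ℝ)
      ≤ (M + 1 : ℝ) ^ R.card * Real.exp (-(weight G B K / (3 * (M + 1)))) := by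
    push_cast
    calc ∏ u ∈ R, ((𝓕.image fun f => f u).card : ℝ)
        ≤ ∏ u ∈ R, ((M + 1 : ℝ) *
          Real.exp ((((𝓕.image fun f => f u).card : ℝ) - (M + 1)) / (M + 1))) := by
          refine prod_le_prod (fun _ _ => by positivity) fun u _ => ?_
          have h1 := Real.add_one_le_exp ((((𝓕.image fun f => f u).card : ℝ) - (M + 1)) / (M + 1))
          calc ((𝓕.image fun f => f u).card : ℝ)
              = (M + 1) * ((((𝓕.image fun f => f u).card : ℝ) - (M + 1)) / (M + 1) + 1) := by
                field_simp; ring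
            _ ≤ _ := mul_le_mul_of_nonneg_left h1 hμ.le
      _ = (M + 1 : ℝ) ^ R.card * Real.exp
          (∑ u ∈ R, (((𝓕.image fun f => f u).card : ℝ) - (M + 1)) / (M + 1)) := by
          rw [prod_mul_distrib, prod_const, Real.exp_sum]
      _ ≤ _ := by
          refine mul_le_mul_of_nonneg_left (Real.exp_le_exp.2 ?_) (by positivity)
          have h2 : ∑ u ∈ R, (((𝓕.image fun f => f u).card : ℝ) - (M + 1)) * 3
              ≤ -(weight G B K : ℝ) := by exact_mod_cast hsum
          rw [← sum_mul] at h2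
          rw [← sum_div, div_le_iff₀ hμ]
          have : -((weight G B K : ℝ) / (3 * (M + 1))) * (M + 1) = -(weight G B K : ℝ) / 3 := by
            field_simp
          rw [this]
          linarith
  have hflip' : (𝓕.card : ℝ) * (M + 1) ^ R.card
      ≤ T.card * ((∏ u ∈ R, (𝓕.image fun f => f u).card : ℕ) : ℝ) := by exact_mod_cast hflip
  have h3 := hflip'.trans (mul_le_mul_of_nonneg_left hprod (by positivity))
  have hpow : (0 : ℝ) < (M + 1 : ℝ) ^ R.card := by positivity
  refine le_of_mul_le_mul_right ?_ hpow
  calc _ ≤ _ := h3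
    _ = _ := by ring

end Resampling

end FlatLipschitz

/-! ### The exponential moment of the weight -/

namespace FlatLipschitz

open Finset

section Moment

/-- A bound on the number of sets of size at most `100 n / d`, from the generating function
`∑ d ^ (-|Z|) = (1 + 1 / d) ^ n`. -/
lemma card_small_sets_le {V : Type*} [Fintype V] [DecidableEq V] {d : ℕ} (hd : 3 ≤ d)
    (𝓩 : Finset (Finset V)) (h𝓩 : ∀ Z ∈ 𝓩, d * Z.card ≤ 100 * Fintype.card V) :
    (𝓩.card : ℝ) ≤ Real.exp (101 * Fintype.card V * Real.log d / d) := by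
  have hd0 : (0 : ℝ) < d := by positivity
  have hd3 : (3 : ℝ) ≤ d := by exact_mod_cast hd
  have hlog : 1 ≤ Real.log d := by
    rw [Real.le_log_iff_exp_le hd0]
    exact (Real.exp_one_lt_d9.le.trans (by norm_num)).trans hd3
  set n : ℝ := (Fintype.card V : ℝ) with hn
  have hn0 : 0 ≤ n := by positivity
  have h1 : ∑ Z ∈ 𝓩, Real.exp (-(100 * n * Real.log d / d)) ≤ Real.exp (n / d) := by
    calc ∑ Z ∈ 𝓩, Real.exp (-(100 * n * Real.log d / d))
        ≤ ∑ Z ∈ 𝓩, ((d : ℝ)⁻¹) ^ Z.card := by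
          refine sum_le_sum fun Z hZ => ?_
          have hcard : (d : ℝ) * Z.card ≤ 100 * n := by rw [hn]; exact_mod_cast h𝓩 Z hZ
          rw [inv_pow, ← Real.exp_log (inv_pos.2 (pow_pos hd0 _)), Real.log_inv, Real.log_pow]
          refine Real.exp_le_exp.2 (neg_le_neg ?_)
          rw [le_div_iff₀ hd0]
          nlinarith
      _ ≤ ∑ Z ∈ (univ : Finset V).powerset, ((d : ℝ)⁻¹) ^ Z.card := by
          refine sum_le_sum_of_subset_of_nonneg (fun Z _ => by simp) fun _ _ _ => by positivity
      _ = ((d : ℝ)⁻¹ + 1) ^ Fintype.card V := by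
          have := sum_pow_mul_eq_add_pow ((d : ℝ)⁻¹) 1 (univ : Finset V)
          simpa using this
      _ ≤ Real.exp ((d : ℝ)⁻¹) ^ Fintype.card V :=
          pow_le_pow_left₀ (by positivity) (Real.add_one_le_exp _) _
      _ = Real.exp (n / d) := by
          rw [← Real.exp_nat_mul, ← hn, div_eq_mul_inv]
  rw [sum_const, nsmul_eq_mul] at h1
  calc (𝓩.card : ℝ) = 𝓩.card * Real.exp (-(100 * n * Real.log d / d))
        * Real.exp (100 * n * Real.log d / d) := by
        rw [mul_assoc, ← Real.exp_add]; simp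
    _ ≤ Real.exp (n / d) * Real.exp (100 * n * Real.log d / d) :=
        mul_le_mul_of_nonneg_right h1 (Real.exp_pos _).le
    _ ≤ Real.exp (101 * n * Real.log d / d) := by
        rw [← Real.exp_add]
        refine Real.exp_le_exp.2 ?_
        rw [← add_div]
        refine div_le_div_of_nonneg_right ?_ hd0.le
        nlinarith

variable {V : Type*} [Fintype V] [DecidableEq V] {G : SimpleGraph V} [DecidableRel G.Adj]

/-- The number of records of size `N` linked to a point near `v`. -/
lemma card_linked_le {d : ℕ} (hreg : G.IsRegularOfDegree d) (hconn : G.Connected) (v : V) (N : ℕ)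
    (𝓚 : Finset (Finset (V × ℕ × Bool)))
    (h𝓚 : ∀ K ∈ 𝓚, K.card = N ∧ ∃ y b, G.dist v y ≤ 2 ∧ IsLinked (closeTo G) (y, 0, b) K) :
    𝓚.card ≤ 2 * (d + 1) ^ 2 * (6 * (d + 1) ^ 7) ^ (2 * N) := by
  classical
  choose 𝓛 h𝓛card h𝓛 using fun x : V × ℕ × Bool => exists_linked_family (nb := closeTo G)
    closeTo_symm (card_closeTo_le hreg hconn) (Nat.mul_pos (by norm_num) (by positivity)) x N
  have hsub : 𝓚 ⊆ ((univ.filter fun y => G.dist v y ≤ 2) ×ˢ (univ : Finset Bool)).biUnion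
      fun p => 𝓛 (p.1, 0, p.2) := by
    intro K hK
    obtain ⟨hN, y, b, hy, hlink⟩ := h𝓚 K hK
    exact mem_biUnion.2 ⟨(y, b), by simpa using hy, h𝓛 _ K hlink hN⟩
  calc 𝓚.card ≤ _ := card_le_card hsub
    _ ≤ ∑ p ∈ (univ.filter fun y => G.dist v y ≤ 2) ×ˢ (univ : Finset Bool),
        (𝓛 (p.1, 0, p.2)).card := card_biUnion_le
    _ ≤ ∑ p ∈ (univ.filter fun y => G.dist v y ≤ 2) ×ˢ (univ : Finset Bool),
        (6 * (d + 1) ^ 7) ^ (2 * N) := sum_le_sum fun p _ => h𝓛card _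
    _ ≤ 2 * (d + 1) ^ 2 * (6 * (d + 1) ^ 7) ^ (2 * N) := by
        rw [sum_const, smul_eq_mul, card_product, card_univ, Fintype.card_bool]
        refine Nat.mul_le_mul_right _ ?_
        have := card_dist_le hreg hconn v 2
        omega

/-- The bookkeeping of constants in the sum over records. -/
lemma linked_count_mul_exp_le {d M N : ℕ} (hd : 30000 ≤ d) (hN : 1 ≤ N)
    (hbig : 30000 * Real.log d * (M + 1) ≤ d) :
    ((2 * (d + 1) ^ 2 * (6 * (d + 1) ^ 7) ^ (2 * N) : ℕ) : ℝ) *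
      (2 * Real.exp (-(d * N / (600 * (M + 1))))) * (5 * (M + 1)) ≤ (1 / 2) * (1 / 2) ^ N := by
  have hd' : (30000 : ℝ) ≤ d := by exact_mod_cast hd
  have hd0 : (0 : ℝ) < d := by linarith
  have hlog : 1 ≤ Real.log d := by
    rw [Real.le_log_iff_exp_le hd0]
    exact (Real.exp_one_lt_d9.le.trans (by norm_num)).trans hd'
  have hM0 : (0 : ℝ) ≤ M := by positivity
  have hμd : (M : ℝ) + 1 ≤ d := by nlinarith
  have hexp : Real.exp (-(d * N / (600 * (M + 1)))) ≤ ((d : ℝ)⁻¹) ^ (50 * N) := by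
    rw [inv_pow, ← Real.exp_log (inv_pos.2 (pow_pos hd0 _)), Real.log_inv, Real.log_pow]
    refine Real.exp_le_exp.2 (neg_le_neg ?_)
    rw [le_div_iff₀ (by positivity)]
    push_cast
    have : (0 : ℝ) ≤ N := by positivity
    nlinarith
  have h1 : (d : ℝ) + 1 ≤ d * (1 + 1 / 30000) := by linarith
  have h2 : ((d : ℝ) + 1) ^ 2 ≤ (d : ℝ) ^ 2 * 2 := by nlinarith
  have h7 : 6 * ((d : ℝ) + 1) ^ 7 ≤ (d : ℝ) ^ 8 := by
    calc 6 * ((d : ℝ) + 1) ^ 7 ≤ 6 * ((d : ℝ) * (1 + 1 / 30000)) ^ 7 := by gcongr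
      _ = (d : ℝ) ^ 7 * (6 * (1 + 1 / 30000) ^ 7) := by ring
      _ ≤ (d : ℝ) ^ 7 * d := by
        refine mul_le_mul_of_nonneg_left ?_ (by positivity)
        exact le_trans (by norm_num) hd'
      _ = (d : ℝ) ^ 8 := by ring
  calc ((2 * (d + 1) ^ 2 * (6 * (d + 1) ^ 7) ^ (2 * N) : ℕ) : ℝ) *
      (2 * Real.exp (-(d * N / (600 * (M + 1))))) * (5 * (M + 1))
      ≤ (2 * ((d : ℝ) ^ 2 * 2) * ((d : ℝ) ^ 8) ^ (2 * N)) * (2 * ((d : ℝ)⁻¹) ^ (50 * N)) * (5 * d) := by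
        push_cast
        gcongr
    _ = (40 * (d : ℝ) ^ 3) * ((d : ℝ) ^ (16 * N) * ((d : ℝ)⁻¹) ^ (50 * N)) := by
        rw [← pow_mul]; ring
    _ = (40 * (d : ℝ) ^ 3) * ((d : ℝ)⁻¹) ^ (34 * N) := by
        rw [show 50 * N = 16 * N + 34 * N by ring, pow_add, ← mul_assoc ((d : ℝ) ^ (16 * N)),
          ← mul_pow, mul_inv_cancel₀ hd0.ne', one_pow, one_mul]
    _ ≤ (d : ℝ) ^ 4 * ((d : ℝ)⁻¹) ^ (4 * N + N) := by
        have e1 : (40 : ℝ) * d ^ 3 ≤ (d : ℝ) ^ 4 := by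
          have : (0 : ℝ) ≤ (d : ℝ) ^ 3 := by positivity
          nlinarith
        have e2 : ((d : ℝ)⁻¹) ^ (34 * N) ≤ ((d : ℝ)⁻¹) ^ (4 * N + N) :=
          pow_le_pow_of_le_one (by positivity) (inv_le_one_of_one_le₀ (by linarith)) (by omega)
        gcongr
    _ ≤ (d : ℝ) ^ 4 * ((d : ℝ)⁻¹) ^ (4 + N) := by
        have e2 : ((d : ℝ)⁻¹) ^ (4 * N + N) ≤ ((d : ℝ)⁻¹) ^ (4 + N) :=
          pow_le_pow_of_le_one (by positivity) (inv_le_one_of_one_le₀ (by linarith)) (by omega)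
        gcongr
    _ = ((d : ℝ)⁻¹) ^ N := by
        rw [pow_add, ← mul_assoc, ← mul_pow, mul_inv_cancel₀ hd0.ne', one_pow, one_mul]
    _ ≤ (1 / 4) ^ N := by
        refine pow_le_pow_left₀ (by positivity) ?_ _
        rw [inv_eq_one_div]
        exact one_div_le_one_div_of_le (by norm_num) (by linarith)
    _ = (1 / 2) ^ N * (1 / 2) ^ N := by rw [← mul_pow]; norm_num
    _ ≤ (1 / 2) * (1 / 2) ^ N := by
        refine mul_le_mul_of_nonneg_right ?_ (by positivity)
        calc (1 / 2 : ℝ) ^ N ≤ (1 / 2) ^ 1 :=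
              pow_le_pow_of_le_one (by norm_num) (by norm_num) hN
          _ = 1 / 2 := by norm_num

/-- The exponential moment of the weight of the certificate at `v`, summed over the functions with
an excursion at `v`. The entropy of the records is beaten by `card_certified_le`, since a record
has only `100 / d` elements per unit of weight. -/
theorem sum_exp_weight_le {d M B : ℕ} {ρ : ℝ} {v : V} {𝓖 T : Finset (V → ℤ)} {L : ℕ}
    (hreg : G.IsRegularOfDegree d) (hconn : G.Connected) (hd : 30000 ≤ d)
    (hbig : 30000 * Real.log d * (M + 1) ≤ d)
    (hT : ∀ g, g ∈ T ↔ (∀ u w, G.Adj u w → |g u - g w| ≤ (M : ℤ)) ∧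
      Fintype.card V ≤ 5 * (univ.filter fun u => 0 ≤ g u ∧ g u ≤ M).card)
    (hTL : T.card ≤ 5 * (M + 1) * L) (h𝓖T : 𝓖 ⊆ T)
    (K : (V → ℤ) → Finset (V × ℕ × Bool)) (Z : (V → ℤ) → Finset V)
    (hcert : ∀ g ∈ 𝓖, IsCertificate G d M B ρ g v (K g) (Z g)) :
    ∑ g ∈ 𝓖, Real.exp (weight G B (K g) / (8 * (M + 1))) ≤ L := by
  classical
  have hd' : (30000 : ℝ) ≤ d := by exact_mod_cast hd
  have hd0 : (0 : ℝ) < d := by linarith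
  set μ : ℝ := (M : ℝ) + 1 with hμdef
  have hμ : 0 < μ := by positivity
  set w : Finset (V × ℕ × Bool) → ℝ := fun K => (weight G B K : ℝ) with hw
  have hw0 : ∀ K, 0 ≤ w K := fun K => by positivity
  set 𝓟 := 𝓖.image fun g => (K g, Z g) with h𝓟
  set 𝓚 := 𝓖.image K with h𝓚
  -- group the functions by certificate
  have step1 : ∑ g ∈ 𝓖, Real.exp (w (K g) / (8 * μ))
      ≤ ∑ p ∈ 𝓟, T.card * Real.exp (-(5 / 24 * (w p.1 / μ))) := by
    rw [← sum_fiberwise_of_maps_to (g := fun g => (K g, Z g)) (t := 𝓟)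
      (fun g hg => mem_image_of_mem _ hg)]
    refine sum_le_sum fun p _ => ?_
    have hfib : ((𝓖.filter fun g => (K g, Z g) = p).card : ℝ)
        ≤ T.card * Real.exp (-(weight G B p.1 / (3 * (M + 1)))) := by
      refine card_certified_le (v := v) (d := d) (ρ := ρ) (Z := p.2) hT
        ((filter_subset _ _).trans h𝓖T) fun g hg => ?_
      obtain ⟨hg1, rfl⟩ := mem_filter.1 hg
      exact hcert g hg1
    calc ∑ g ∈ 𝓖 with (K g, Z g) = p, Real.exp (w (K g) / (8 * μ))
        = ∑ g ∈ 𝓖 with (K g, Z g) = p, Real.exp (w p.1 / (8 * μ)) := by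
          refine sum_congr rfl fun g hg => ?_
          rw [← (mem_filter.1 hg).2]
      _ = (𝓖.filter fun g => (K g, Z g) = p).card * Real.exp (w p.1 / (8 * μ)) := by
          rw [sum_const, nsmul_eq_mul]
      _ ≤ T.card * Real.exp (-(w p.1 / (3 * μ))) * Real.exp (w p.1 / (8 * μ)) :=
          mul_le_mul_of_nonneg_right hfib (Real.exp_pos _).le
      _ = T.card * Real.exp (-(5 / 24 * (w p.1 / μ))) := by
          rw [mul_assoc, ← Real.exp_add]
          congr 2
          field_simp
          ring
  -- sum over the auxiliary sets
  have haux : ∀ K₀ ∈ 𝓚, ((𝓟.filter fun p => p.1 = K₀).card : ℝ)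
      ≤ 2 * Real.exp (1 / 24 * (w K₀ / μ)) := by
    intro K₀ hK₀
    have hone : 1 ≤ Real.exp (1 / 24 * (w K₀ / μ)) :=
      Real.one_le_exp (by have := hw0 K₀; positivity)
    have hcard : (𝓟.filter fun p => p.1 = K₀).card
        = ((𝓟.filter fun p => p.1 = K₀).image Prod.snd).card := by
      rw [card_image_of_injOn]
      intro p hp q hq hpq
      exact Prod.ext ((mem_filter.1 hp).2.trans (mem_filter.1 hq).2.symm) hpq
    set 𝓩 := (𝓟.filter fun p => p.1 = K₀).image Prod.snd with h𝓩
    have hmem : ∀ Y ∈ 𝓩, Y = ∅ ∨ d * Y.card ≤ 100 * Fintype.card V ∧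
        3 * Fintype.card V ≤ 5 * weight G B K₀ := by
      intro Y hY
      obtain ⟨p, hp, rfl⟩ := mem_image.1 hY
      obtain ⟨hp1, rfl⟩ := mem_filter.1 hp
      obtain ⟨g, hg, rfl⟩ := mem_image.1 hp1
      exact (hcert g hg).aux
    rw [hcard]
    by_cases hlarge : 3 * Fintype.card V ≤ 5 * weight G B K₀
    · have h1 := card_small_sets_le (d := d) (by omega) 𝓩 fun Y hY => by
        rcases hmem Y hY with rfl | h
        · simp
        · exact h.1
      have h2 : 3 * (Fintype.card V : ℝ) ≤ 5 * w K₀ := by simp only [hw]; exact_mod_cast hlarge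
      have h3 : Real.log d * μ * 30000 ≤ d := by linarith
      have hlog : 0 ≤ Real.log d := Real.log_nonneg (by linarith)
      have h4 : 101 * (Fintype.card V : ℝ) * Real.log d / d ≤ 1 / 24 * (w K₀ / μ) := by
        rw [div_le_iff₀ hd0]
        calc 101 * (Fintype.card V : ℝ) * Real.log d ≤ 101 * (5 / 3 * w K₀) * Real.log d := by
              gcongr; linarith
          _ = w K₀ / μ * (Real.log d * μ) * (505 / 3) := by field_simp; ring
          _ ≤ w K₀ / μ * (d / 30000) * (505 / 3) := by
              have := hw0 K₀
              gcongr
              linarith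
          _ ≤ 1 / 24 * (w K₀ / μ) * d := by
              have : 0 ≤ w K₀ / μ * d := by have := hw0 K₀; positivity
              nlinarith
      have h5 := h1.trans (Real.exp_le_exp.2 h4)
      linarith
    · have h1 : 𝓩 ⊆ {∅} := fun Y hY => by
        rcases hmem Y hY with rfl | h
        · simp
        · exact absurd h.2 hlarge
      have h2 : (𝓩.card : ℝ) ≤ 1 := by exact_mod_cast card_le_card h1
      linarith
  have step2 : ∑ p ∈ 𝓟, T.card * Real.exp (-(5 / 24 * (w p.1 / μ)))
      ≤ ∑ K₀ ∈ 𝓚, T.card * (2 * Real.exp (-(d * K₀.card / (600 * μ)))) := by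
    rw [← sum_fiberwise_of_maps_to (g := Prod.fst) (t := 𝓚) (fun p hp => by
      obtain ⟨g, hg, rfl⟩ := mem_image.1 hp
      exact mem_image_of_mem _ hg)]
    refine sum_le_sum fun K₀ hK₀ => ?_
    calc ∑ p ∈ 𝓟 with p.1 = K₀, T.card * Real.exp (-(5 / 24 * (w p.1 / μ)))
        = ∑ p ∈ 𝓟 with p.1 = K₀, T.card * Real.exp (-(5 / 24 * (w K₀ / μ))) :=
          sum_congr rfl fun p hp => by rw [(mem_filter.1 hp).2]
      _ = (𝓟.filter fun p => p.1 = K₀).card * (T.card * Real.exp (-(5 / 24 * (w K₀ / μ)))) := by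
          rw [sum_const, nsmul_eq_mul]
      _ ≤ 2 * Real.exp (1 / 24 * (w K₀ / μ)) * (T.card * Real.exp (-(5 / 24 * (w K₀ / μ)))) :=
          mul_le_mul_of_nonneg_right (haux K₀ hK₀) (by positivity)
      _ = T.card * (2 * Real.exp (-(w K₀ / (6 * μ)))) := by
          rw [show -(w K₀ / (6 * μ)) = 1 / 24 * (w K₀ / μ) + -(5 / 24 * (w K₀ / μ)) by
            field_simp; ring, Real.exp_add]
          ring
      _ ≤ T.card * (2 * Real.exp (-(d * K₀.card / (600 * μ)))) := by
          obtain ⟨g, hg, rfl⟩ := mem_image.1 hK₀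
          have h1 : (d : ℝ) * (K g).card ≤ 100 * w (K g) := by
            simp only [hw]; exact_mod_cast (hcert g hg).card_le
          refine mul_le_mul_of_nonneg_left (mul_le_mul_of_nonneg_left (Real.exp_le_exp.2
            (neg_le_neg ?_)) zero_le_two) (by positivity)
          rw [div_le_div_iff₀ (by positivity) (by positivity)]
          nlinarith
  -- sum over the records by size
  have hpos : ∀ K₀ ∈ 𝓚, 1 ≤ K₀.card := by
    intro K₀ hK₀
    obtain ⟨g, hg, rfl⟩ := mem_image.1 hK₀
    obtain ⟨y, b, -, hl⟩ := (hcert g hg).linked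
    exact card_pos.2 ⟨_, hl.1⟩
  have step3 : ∑ K₀ ∈ 𝓚, (2 * Real.exp (-(d * K₀.card / (600 * μ)))) * (5 * μ) ≤ 1 := by
    set m := 𝓚.sup card with hm
    rw [← sum_fiberwise_of_maps_to (g := card) (t := range (m + 1)) (fun K₀ hK₀ =>
      mem_range.2 (Nat.lt_succ_of_le (le_sup (f := card) hK₀)))]
    calc ∑ N ∈ range (m + 1), ∑ K₀ ∈ 𝓚 with K₀.card = N,
          (2 * Real.exp (-(d * K₀.card / (600 * μ)))) * (5 * μ)
        ≤ ∑ N ∈ range (m + 1), (1 / 2 : ℝ) * (1 / 2) ^ N := by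
          refine sum_le_sum fun N _ => ?_
          rcases Nat.eq_zero_or_pos N with rfl | hN
          · rw [sum_eq_zero fun K₀ hK₀ => ?_]
            · positivity
            · have h1 := hpos K₀ (mem_filter.1 hK₀).1
              have h2 := (mem_filter.1 hK₀).2
              omega
          · have hcount := card_linked_le hreg hconn v N (𝓚.filter fun K₀ => K₀.card = N)
              fun K₀ hK₀ => by
                obtain ⟨h1, h2⟩ := mem_filter.1 hK₀
                obtain ⟨g, hg, rfl⟩ := mem_image.1 h1
                exact ⟨h2, (hcert g hg).linked⟩
            have hc : ((𝓚.filter fun K₀ => K₀.card = N).card : ℝ)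
                ≤ ((2 * (d + 1) ^ 2 * (6 * (d + 1) ^ 7) ^ (2 * N) : ℕ) : ℝ) := by
              exact_mod_cast hcount
            calc ∑ K₀ ∈ 𝓚 with K₀.card = N, (2 * Real.exp (-(d * K₀.card / (600 * μ)))) * (5 * μ)
                = ∑ K₀ ∈ 𝓚 with K₀.card = N, (2 * Real.exp (-(d * N / (600 * μ)))) * (5 * μ) :=
                  sum_congr rfl fun K₀ hK₀ => by rw [(mem_filter.1 hK₀).2]
              _ = (𝓚.filter fun K₀ => K₀.card = N).card
                    * (2 * Real.exp (-(d * N / (600 * μ)))) * (5 * μ) := by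
                  rw [sum_const, nsmul_eq_mul]; ring
              _ ≤ _ := by
                  gcongr
              _ ≤ _ := linked_count_mul_exp_le hd hN hbig
      _ ≤ 1 := by
          rw [← mul_sum]
          have := sum_geometric_two_le (m + 1)
          linarith
  have hTL' : (T.card : ℝ) ≤ 5 * μ * L := by rw [hμdef]; exact_mod_cast hTL
  calc ∑ g ∈ 𝓖, Real.exp (weight G B (K g) / (8 * μ)) ≤ _ := step1
    _ ≤ _ := step2
    _ ≤ ∑ K₀ ∈ 𝓚, 5 * μ * L * (2 * Real.exp (-(d * K₀.card / (600 * μ)))) := by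
        gcongr
    _ = L * ∑ K₀ ∈ 𝓚, (2 * Real.exp (-(d * K₀.card / (600 * μ)))) * (5 * μ) := by
        rw [mul_sum]
        exact sum_congr rfl fun _ _ => by ring
    _ ≤ L * 1 := mul_le_mul_of_nonneg_left step3 (by positivity)
    _ = L := mul_one _

end Moment

end FlatLipschitz

/-! ### Excursions of a uniformly random Lipschitz function -/

namespace FlatLipschitz

open Finset

section Global

variable {V : Type*} [Fintype V] [DecidableEq V] {G : SimpleGraph V} [DecidableRel G.Adj]

lemma abs_sub_le_mul_dist (hconn : G.Connected) {M : ℕ} {f : V → ℤ}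
    (hf : ∀ u v, G.Adj u v → |f u - f v| ≤ (M : ℤ)) (u v : V) :
    |f u - f v| ≤ M * G.dist u v := by
  obtain ⟨p, hp⟩ := hconn.exists_walk_length_eq_dist u v
  rw [← hp]
  clear hp
  induction p with
  | nil => simp
  | @cons u w v hadj q ih =>
    rw [SimpleGraph.Walk.length_cons]
    push_cast
    have h1 := hf u w hadj
    have h2 := abs_sub_le (f u) (f w) (f v)
    linarith

lemma exists_dist_le (G : SimpleGraph V) : ∃ D : ℕ, ∀ u v, G.dist u v ≤ D := by
  obtain ⟨D, hD⟩ := (Set.finite_range fun p : V × V => G.dist p.1 p.2).bddAbove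
  exact ⟨D, fun u v => hD ⟨(u, v), rfl⟩⟩

lemma finite_lipschitzFunctions (hconn : G.Connected) (v₀ : V) (M : ℕ) :
    (lipschitzFunctions G v₀ M).Finite := by
  obtain ⟨D, hD⟩ := exists_dist_le G
  refine (Set.finite_Icc (fun _ : V => -((M : ℤ) * D)) (fun _ => (M : ℤ) * D)).subset ?_
  rintro f ⟨hf0, hf⟩
  have : ∀ v, |f v| ≤ M * D := fun v => by
    have h1 := abs_sub_le_mul_dist hconn hf v v₀
    rw [hf0, sub_zero] at h1
    exact h1.trans (mul_le_mul_of_nonneg_left (by exact_mod_cast hD v v₀) (by positivity))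
  exact ⟨fun v => (abs_le.1 (this v)).1, fun v => (abs_le.1 (this v)).2⟩

/-- There are at most `5 (M + 1)` times as many Lipschitz functions with a fifth of their values
in the bulk as there are Lipschitz functions pinned at `v₀`: counting pairs of such a function and
a vertex in the bulk, the function is recovered from its pinned translate, the vertex and the
value there. -/
lemma exists_bulk_functions (hconn : G.Connected) {M : ℕ} {v₀ : V} {𝓛 : Finset (V → ℤ)}
    (h𝓛 : ∀ f, f ∈ 𝓛 ↔ f v₀ = 0 ∧ ∀ u v, G.Adj u v → |f u - f v| ≤ (M : ℤ)) :
    ∃ T : Finset (V → ℤ), (∀ g, g ∈ T ↔ (∀ u w, G.Adj u w → |g u - g w| ≤ (M : ℤ)) ∧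
      Fintype.card V ≤ 5 * (univ.filter fun u => 0 ≤ g u ∧ g u ≤ M).card) ∧
      T.card ≤ 5 * (M + 1) * 𝓛.card := by
  classical
  have hn : 0 < Fintype.card V := Fintype.card_pos_iff.2 ⟨v₀⟩
  obtain ⟨D, hD⟩ := exists_dist_le G
  have hfin : {g : V → ℤ | (∀ u w, G.Adj u w → |g u - g w| ≤ (M : ℤ)) ∧
      Fintype.card V ≤ 5 * (univ.filter fun u => 0 ≤ g u ∧ g u ≤ (M : ℤ)).card}.Finite := by
    refine (Set.finite_Icc (fun _ : V => -((M : ℤ) * D)) (fun _ => (M : ℤ) + M * D)).subset ?_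
    rintro g ⟨hg, hcard⟩
    have hpos : 0 < (univ.filter fun u => 0 ≤ g u ∧ g u ≤ (M : ℤ)).card := by omega
    obtain ⟨w, hw⟩ := card_pos.1 hpos
    simp only [mem_filter, mem_univ, true_and] at hw
    have h1 : ∀ v, |g v - g w| ≤ M * D := fun v =>
      (abs_sub_le_mul_dist hconn hg v w).trans
        (mul_le_mul_of_nonneg_left (by exact_mod_cast hD v w) (by positivity))
    constructor <;> intro v <;> have := abs_le.1 (h1 v) <;> dsimp only <;> linarith
  refine ⟨hfin.toFinset, fun g => by simp, ?_⟩
  set T := hfin.toFinset with hT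
  have hmem : ∀ g ∈ T, (∀ u w, G.Adj u w → |g u - g w| ≤ (M : ℤ)) ∧
      Fintype.card V ≤ 5 * (univ.filter fun u => 0 ≤ g u ∧ g u ≤ (M : ℤ)).card := by
    intro g hg
    simpa [hT] using hg
  let E := T.sigma fun g => univ.filter fun u => 0 ≤ g u ∧ g u ≤ (M : ℤ)
  have hE1 : Fintype.card V * T.card ≤ 5 * E.card := by
    rw [card_sigma, mul_sum]
    calc Fintype.card V * T.card = ∑ g ∈ T, Fintype.card V := by
          rw [sum_const, smul_eq_mul, mul_comm]
      _ ≤ _ := sum_le_sum fun g hg => (hmem g hg).2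
  have hE2 : E.card ≤ (𝓛 ×ˢ ((univ : Finset V) ×ˢ Icc 0 (M : ℤ))).card := by
    refine card_le_card_of_injOn
      (fun p => (fun v => p.1 v - p.1 v₀, p.2, p.1 p.2)) ?_ ?_
    · rintro ⟨g, u⟩ hp
      obtain ⟨hg, hu⟩ := mem_sigma.1 hp
      have hu := (mem_filter.1 hu).2
      refine mem_product.2 ⟨(h𝓛 _).2 ⟨sub_self _, fun x y hxy => ?_⟩,
        mem_product.2 ⟨mem_univ _, mem_Icc.2 hu⟩⟩
      have := (hmem g hg).1 x y hxy
      rwa [sub_sub_sub_cancel_right]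
    · rintro ⟨g, u⟩ - ⟨g', u'⟩ - heq
      simp only [Prod.mk.injEq] at heq
      obtain ⟨h1, rfl, h3⟩ := heq
      have h4 := congrFun h1 u
      have : g = g' := by
        funext v
        have h5 := congrFun h1 v
        omega
      rw [this]
  rw [card_product, card_product, card_univ, Int.card_Icc,
    show ((M : ℤ) + 1 - 0).toNat = M + 1 by omega] at hE2
  have h6 : Fintype.card V * T.card ≤ Fintype.card V * (5 * (M + 1) * 𝓛.card) := by
    calc _ ≤ 5 * E.card := hE1
      _ ≤ 5 * (𝓛.card * (Fintype.card V * (M + 1))) := Nat.mul_le_mul_left _ hE2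
      _ = _ := by ring
  exact Nat.le_of_mul_le_mul_left h6 hn

/-- Every pinned Lipschitz function has a translate whose excursions out of the bulk `[0, M]` have
weights `W` with bounded exponential moment, and the weight at a vertex dominates the height of
the excursion there. -/
theorem exists_excursion_weight {d M : ℕ} {lam : ℝ} (h : IsLambdaExpander G d lam)
    (hconn : G.Connected) (hd : 30000 ≤ d) (hbig : 30000 * Real.log d * (M + 1) ≤ d)
    (hlam0 : 0 < lam) (hlam : lam ≤ (d : ℝ) / 5) {v₀ : V} {𝓛 : Finset (V → ℤ)}
    (h𝓛 : ∀ f, f ∈ 𝓛 ↔ f v₀ = 0 ∧ ∀ u v, G.Adj u v → |f u - f v| ≤ (M : ℤ)) :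
    ∃ (s : (V → ℤ) → ℤ) (W : (V → ℤ) → V → ℕ),
      (∀ f ∈ 𝓛, ∀ v, ¬(0 ≤ f v + s f ∧ f v + s f ≤ M) → ∀ b,
        99 * (d : ℤ) * (side M b (fun u => f u + s f) v - M) ≤ 100 * W f v ∧
        ∀ t : ℕ, 2 * (M : ℤ) + t * M ≤ side M b (fun u => f u + s f) v →
          (M : ℝ) * ((39 * d / (100 * lam)) ^ 2) ^ t ≤ W f v) ∧
      ∀ v, ∑ f ∈ 𝓛 with ¬(0 ≤ f v + s f ∧ f v + s f ≤ M),
        Real.exp (W f v / (8 * (M + 1))) ≤ 𝓛.card := by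
  classical
  have : Nonempty V := ⟨v₀⟩
  have hdpos : 0 < d := by omega
  obtain ⟨T, hT, hTcard⟩ := exists_bulk_functions hconn h𝓛
  obtain ⟨D, hD⟩ := exists_dist_le G
  choose s hs using fun f => exists_isCentred_add h hdpos hlam0.le hlam M f
  have hlip : ∀ f ∈ 𝓛, ∀ u v, G.Adj u v → |(f u + s f) - (f v + s f)| ≤ (M : ℤ) := by
    intro f hf u v huv
    rw [add_sub_add_right_eq_sub]
    exact ((h𝓛 f).1 hf).2 u v huv
  have hgT : ∀ f ∈ 𝓛, (fun u => f u + s f) ∈ T := fun f hf =>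
    (hT _).2 ⟨hlip f hf, card_bulk_ge h hdpos hlam0.le hlam (hlip f hf) (hs f)⟩
  have hB : ∀ f ∈ 𝓛, ∀ b u, side M b (fun u => f u + s f) u ≤ (M : ℤ) + (M * D : ℕ) := by
    intro f hf b u
    have hcard := ((hT _).1 (hgT f hf)).2
    have hn : 0 < Fintype.card V := Fintype.card_pos
    have hpos : 0 < (univ.filter fun u => 0 ≤ f u + s f ∧ f u + s f ≤ (M : ℤ)).card := by omega
    obtain ⟨w, hw⟩ := card_pos.1 hpos
    simp only [mem_filter, mem_univ, true_and] at hw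
    have h1 := (abs_sub_le_mul_dist hconn (hlip f hf) u w).trans
      (mul_le_mul_of_nonneg_left (show (G.dist u w : ℤ) ≤ D by exact_mod_cast hD u w)
        (by positivity))
    have h2 := abs_le.1 h1
    push_cast
    cases b
    · simp only [side, Bool.false_eq_true, if_false]; linarith
    · simp only [side, if_true]; linarith
  have hex : ∀ f v, ∃ KZ : Finset (V × ℕ × Bool) × Finset V,
      f ∈ 𝓛 → ¬(0 ≤ f v + s f ∧ f v + s f ≤ M) →
      IsCertificate G d M (M * D) ((39 * d / (100 * lam)) ^ 2) (fun u => f u + s f) v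
        KZ.1 KZ.2 := by
    intro f v
    by_cases hf : f ∈ 𝓛
    · by_cases hv : 0 ≤ f v + s f ∧ f v + s f ≤ M
      · exact ⟨(∅, ∅), fun _ h => absurd hv h⟩
      · obtain ⟨K, Z, hKZ⟩ := exists_isCertificate h hconn hdpos hlam0 hlam (hlip f hf) (hs f)
          (hB f hf) hv
        exact ⟨(K, Z), fun _ _ => hKZ⟩
    · exact ⟨(∅, ∅), fun h => absurd h hf⟩
  choose KZ hKZ using hex
  refine ⟨s, fun f v => weight G (M * D) (KZ f v).1, fun f hf v hv b =>
    ⟨(hKZ f v hf hv).linear b, (hKZ f v hf hv).growth b⟩, fun v => ?_⟩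
  -- transfer to the centred translates, which determine the pinned functions
  have hpin : ∀ f ∈ 𝓛, (fun u => (f u + s f) - (f v₀ + s f)) = f := by
    intro f hf
    funext u
    rw [((h𝓛 f).1 hf).1]
    ring
  set 𝓑 := 𝓛.filter fun f => ¬(0 ≤ f v + s f ∧ f v + s f ≤ M) with h𝓑
  have hinv : ∀ f ∈ 𝓑, (fun u => (fun u => f u + s f) u - (fun u => f u + s f) v₀) = f :=
    fun f hf => hpin f (mem_filter.1 hf).1
  have hinj : Set.InjOn (fun (f : V → ℤ) u => f u + s f) 𝓑 := by
    intro f hf f' hf' heq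
    dsimp only at heq
    rw [← hinv f hf, ← hinv f' hf', heq]
  let unpin : (V → ℤ) → (V → ℤ) := fun g u => g u - g v₀
  have hmain := sum_exp_weight_le (v := v) (𝓖 := 𝓑.image fun f u => f u + s f) h.1 hconn hd hbig hT
    hTcard (fun g hg => by
      obtain ⟨f, hf, rfl⟩ := mem_image.1 hg
      exact hgT f (mem_filter.1 hf).1)
    (fun g => (KZ (unpin g) v).1) (fun g => (KZ (unpin g) v).2)
    (ρ := (39 * d / (100 * lam)) ^ 2) (B := M * D) (fun g hg => by
      obtain ⟨f, hf, rfl⟩ := mem_image.1 hg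
      have := hKZ f v (mem_filter.1 hf).1 (mem_filter.1 hf).2
      have e : unpin (fun u => f u + s f) = f := hinv f hf
      rw [e]
      exact this)
  rw [sum_image hinj] at hmain
  refine le_trans (le_of_eq (sum_congr rfl fun f hf => ?_)) hmain
  have e : unpin (fun u => f u + s f) = f := hinv f hf
  dsimp only
  rw [e]

end Global

end FlatLipschitz

/-! ### Probability, variance and range -/

namespace FlatLipschitz

open Finset

section Uniform

open MeasureTheory ProbabilityTheory

lemma uniformOn_real_eq {Ω : Type*} [DecidableEq Ω] [MeasurableSpace Ω]
    [MeasurableSingletonClass Ω] (s : Finset Ω) (p : Ω → Prop) [DecidablePred p] :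
    (uniformOn (s : Set Ω)).real {x | p x} = ((s.filter p).card : ℝ) / s.card := by
  rw [Measure.real, ← uniformOn_inter_self s.finite_toSet]
  have : (s : Set Ω) ∩ {x | p x} = ((s.filter p : Finset Ω) : Set Ω) := by ext; simp
  rw [this, uniformOn_apply_finset, inter_eq_right.2 (filter_subset _ _), ENNReal.toReal_div]
  simp

lemma integral_uniformOn_eq {Ω : Type*} [MeasurableSpace Ω] [MeasurableSingletonClass Ω]
    (s : Finset Ω) (X : Ω → ℝ) :
    ∫ x, X x ∂(uniformOn (s : Set Ω)) = (∑ x ∈ s, X x) / s.card := by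
  have hint : IntegrableOn X s Measure.count := by
    rw [← show ⋃ x ∈ s, {x} = (s : Set Ω) by ext; simp, integrableOn_finset_iUnion]
    intro x _
    exact integrableOn_singleton (hx := by simp)
  rw [uniformOn, ProbabilityTheory.cond, integral_smul_measure, setIntegral_finset s hint]
  simp [Measure.real, Measure.count_apply_finset, div_eq_inv_mul]

end Uniform

section Tails

variable {V : Type*} [Fintype V] [DecidableEq V] {G : SimpleGraph V} [DecidableRel G.Adj]

/-- The second moment of a centred translate: the height of an excursion has an exponential
moment. -/
lemma sum_sq_centred_le {d M : ℕ} (hd : 30000 ≤ d) (hbig : 30000 * Real.log d * (M + 1) ≤ d)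
    (hM : 1 ≤ M) {𝓛 : Finset (V → ℤ)} {s : (V → ℤ) → ℤ} {W : (V → ℤ) → V → ℕ} (v : V)
    (hW : ∀ f ∈ 𝓛, ¬(0 ≤ f v + s f ∧ f v + s f ≤ M) → ∀ b,
      99 * (d : ℤ) * (side M b (fun u => f u + s f) v - M) ≤ 100 * W f v)
    (hsum : ∑ f ∈ 𝓛 with ¬(0 ≤ f v + s f ∧ f v + s f ≤ M),
      Real.exp (W f v / (8 * (M + 1))) ≤ 𝓛.card) :
    ∑ f ∈ 𝓛, ((f v + s f : ℤ) : ℝ) ^ 2 ≤ 4 * (M : ℝ) ^ 2 * 𝓛.card := by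
  have hd' : (30000 : ℝ) ≤ d := by exact_mod_cast hd
  have hM' : (1 : ℝ) ≤ M := by exact_mod_cast hM
  have hlog : 1 ≤ Real.log d := by
    rw [Real.le_log_iff_exp_le (by linarith)]
    exact (Real.exp_one_lt_d9.le.trans (by norm_num)).trans hd'
  have hterm : ∀ f ∈ 𝓛, ((f v + s f : ℤ) : ℝ) ^ 2 ≤ 2 * (M : ℝ) ^ 2 +
      2 * if ¬(0 ≤ f v + s f ∧ f v + s f ≤ M) then Real.exp (W f v / (8 * (M + 1))) else 0 := by
    intro f hf
    split_ifs with hbad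
    · have h0 : (0 : ℝ) ≤ ((f v + s f : ℤ) : ℝ) := by exact_mod_cast hbad.1
      have h1 : ((f v + s f : ℤ) : ℝ) ≤ M := by exact_mod_cast hbad.2
      nlinarith
    · obtain ⟨b, m, hm, habs⟩ : ∃ b, ∃ m : ℤ, side M b (fun u => f u + s f) v - M = m ∧
          0 ≤ m ∧ |f v + s f| ≤ M + m := by
        by_cases hpos : 0 ≤ f v + s f
        · refine ⟨true, _, rfl, ?_⟩
          simp only [side, if_true]
          rw [abs_le]
          omega
        · refine ⟨false, _, rfl, ?_⟩
          simp only [side, Bool.false_eq_true, if_false]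
          rw [abs_le]
          omega
      have hm0 : (0 : ℝ) ≤ m := by exact_mod_cast habs.1
      have hlin := hW f hf hbad b
      rw [hm] at hlin
      have hlin' : 99 * (d : ℝ) * m ≤ 100 * W f v := by exact_mod_cast hlin
      have hsq : ((f v + s f : ℤ) : ℝ) ^ 2 ≤ ((M : ℝ) + m) ^ 2 := by
        rw [← sq_abs]
        refine pow_le_pow_left₀ (abs_nonneg _) ?_ 2
        exact_mod_cast habs.2
      have hx : 2 * (m : ℝ) ≤ W f v / (8 * (M + 1)) := by
        rw [le_div_iff₀ (by positivity)]
        have h1 : 30000 * ((M : ℝ) + 1) ≤ d := by nlinarith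
        nlinarith
      have hexp := Real.quadratic_le_exp_of_nonneg
        (show (0 : ℝ) ≤ W f v / (8 * (M + 1)) by positivity)
      have hm2 : (2 * (m : ℝ)) ^ 2 ≤ (W f v / (8 * (M + 1)) : ℝ) ^ 2 :=
        pow_le_pow_left₀ (by positivity) hx 2
      have hx0 : (0 : ℝ) ≤ W f v / (8 * (M + 1)) := by positivity
      nlinarith [sq_nonneg ((M : ℝ) - m)]
  calc ∑ f ∈ 𝓛, ((f v + s f : ℤ) : ℝ) ^ 2 ≤ _ := sum_le_sum hterm
    _ = 2 * (M : ℝ) ^ 2 * 𝓛.card + 2 * ∑ f ∈ 𝓛 with ¬(0 ≤ f v + s f ∧ f v + s f ≤ M),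
        Real.exp (W f v / (8 * (M + 1))) := by
        rw [sum_add_distrib, sum_filter, mul_sum, sum_const, nsmul_eq_mul, mul_comm (#𝓛 : ℝ)]
    _ ≤ 2 * (M : ℝ) ^ 2 * 𝓛.card + 2 * 𝓛.card := by linarith
    _ ≤ 4 * (M : ℝ) ^ 2 * 𝓛.card := by
        have h1 : (0 : ℝ) ≤ 𝓛.card := by positivity
        have h2 : (1 : ℝ) ≤ (M : ℝ) ^ 2 := one_le_pow₀ hM'
        nlinarith

/-- A union bound: functions with an excursion of large weight are rare. -/
lemma card_heavy_le {M : ℕ} {𝓛 : Finset (V → ℤ)} {s : (V → ℤ) → ℤ} {W : (V → ℤ) → V → ℕ}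
    (hsum : ∀ v, ∑ f ∈ 𝓛 with ¬(0 ≤ f v + s f ∧ f v + s f ≤ M),
      Real.exp (W f v / (8 * (M + 1))) ≤ 𝓛.card) {a : ℝ} (𝓔 : Finset (V → ℤ)) (h𝓔 : 𝓔 ⊆ 𝓛)
    (hheavy : ∀ f ∈ 𝓔, ∃ v, ¬(0 ≤ f v + s f ∧ f v + s f ≤ M) ∧ a ≤ W f v / (8 * (M + 1))) :
    (𝓔.card : ℝ) ≤ Fintype.card V * Real.exp (-a) * 𝓛.card := by
  classical
  have hmain : (𝓔.card : ℝ) * Real.exp a ≤ Fintype.card V * 𝓛.card := by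
    calc (𝓔.card : ℝ) * Real.exp a = ∑ f ∈ 𝓔, Real.exp a := by rw [sum_const, nsmul_eq_mul]
      _ ≤ ∑ f ∈ 𝓔, ∑ v : V, if ¬(0 ≤ f v + s f ∧ f v + s f ≤ M) then
            Real.exp (W f v / (8 * (M + 1))) else 0 := by
          refine sum_le_sum fun f hf => ?_
          obtain ⟨v, hv, ha⟩ := hheavy f hf
          refine le_trans ?_ (single_le_sum (f := fun v =>
            if ¬(0 ≤ f v + s f ∧ f v + s f ≤ M) then Real.exp (W f v / (8 * (M + 1))) else 0)
            (fun v _ => ?_) (mem_univ v))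
          · rw [if_pos hv]
            exact Real.exp_le_exp.2 ha
          · split_ifs <;> positivity
      _ ≤ ∑ f ∈ 𝓛, ∑ v : V, if ¬(0 ≤ f v + s f ∧ f v + s f ≤ M) then
            Real.exp (W f v / (8 * (M + 1))) else 0 := by
          refine sum_le_sum_of_subset_of_nonneg h𝓔 fun f _ _ => sum_nonneg fun v _ => ?_
          split_ifs <;> positivity
      _ = ∑ v : V, ∑ f ∈ 𝓛 with ¬(0 ≤ f v + s f ∧ f v + s f ≤ M),
            Real.exp (W f v / (8 * (M + 1))) := by
          rw [sum_comm]
          exact sum_congr rfl fun v _ => (sum_filter _ _).symm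
      _ ≤ ∑ v : V, (𝓛.card : ℝ) := sum_le_sum fun v _ => hsum v
      _ = Fintype.card V * 𝓛.card := by rw [sum_const, nsmul_eq_mul, card_univ]
  rw [Real.exp_neg, mul_right_comm, ← div_eq_mul_inv, le_div_iff₀ (Real.exp_pos a)]
  exact hmain

lemma cube_le_pow_of_log_ratio_le {y L : ℝ} {t : ℕ} (hy : 1 ≤ y) (hL : 5 ≤ L)
    (ht : 6 * (Real.log y / Real.log L) ≤ t) : y ^ 3 ≤ ((39 / 100 * L) ^ 2) ^ t := by
  have hL0 : 0 < L := by linarith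
  have hlogL : 0 < Real.log L := Real.log_pos (by linarith)
  have hsq : L ≤ ((39 / 100 * L) ^ 2) ^ 2 := by
    have h3 : (125 : ℝ) ≤ L ^ 3 :=
      le_trans (by norm_num) (pow_le_pow_left₀ (by norm_num) hL 3)
    have h4 : ((39 / 100 * L) ^ 2) ^ 2 = (39 / 100) ^ 4 * L ^ 3 * L := by ring
    rw [h4]
    exact le_mul_of_one_le_left hL0.le (by linarith)
  have hlog : Real.log L ≤ 2 * Real.log ((39 / 100 * L) ^ 2) := by
    have h1 := Real.log_le_log hL0 hsq
    rw [Real.log_pow] at h1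
    exact_mod_cast h1
  have hlog0 : 0 ≤ Real.log ((39 / 100 * L) ^ 2) := by linarith
  rw [← Real.log_le_log_iff (by positivity) (by positivity), Real.log_pow, Real.log_pow]
  have h1 : Real.log y = Real.log y / Real.log L * Real.log L := by
    rw [div_mul_cancel₀ _ hlogL.ne']
  have h2 := mul_le_mul_of_nonneg_right ht hlog0
  have h3 := mul_le_mul_of_nonneg_left hlog
    (div_nonneg (Real.log_nonneg hy) hlogL.le)
  push_cast
  linarith

/-- The height of the excursion forced by a large range makes its weight at least of order
`log n`. If `d` is at least of order `log n`, already half a step of height `M` is enough;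
otherwise `log log n / log (d / lam)` is bounded below, and that many steps of height `M`, each
multiplying the excursion by a power of `d / lam`, take it to polylogarithmic size. -/
lemma two_mul_log_le_weight {d M n : ℕ} {lam x : ℝ} {w : ℕ} (hd : 30000 ≤ d) (hdn : d ≤ n)
    (hM : 1 ≤ M) (hlam0 : 0 < lam) (hlam1 : 1 ≤ lam) (hlam : lam ≤ (d : ℝ) / 5)
    (hx : 24 * (M : ℝ) * (Real.logb 2 (Real.logb 2 n) / Real.logb 2 (d / lam)) + M + 1
      ≤ 2 * (x - M))
    (hlin : 99 * (d : ℝ) * (x - M) ≤ 100 * w)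
    (hgrow : ∀ t : ℕ, 2 * (M : ℝ) + t * M ≤ x →
      (M : ℝ) * ((39 * d / (100 * lam)) ^ 2) ^ t ≤ w) :
    2 * Real.log n ≤ w / (8 * (M + 1)) := by
  have hd' : (30000 : ℝ) ≤ d := by exact_mod_cast hd
  have hdn' : (d : ℝ) ≤ n := by exact_mod_cast hdn
  have hM' : (1 : ℝ) ≤ M := by exact_mod_cast hM
  have hd0 : (0 : ℝ) < d := by linarith
  have hn0 : (0 : ℝ) < n := by linarith
  set L : ℝ := d / lam with hL
  have hL5 : 5 ≤ L := by rw [hL, le_div_iff₀ hlam0]; linarith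
  have hLd : L ≤ d := div_le_self hd0.le hlam1
  set y : ℝ := Real.logb 2 n with hy
  have hy14 : 14 ≤ y := by
    rw [hy, Real.le_logb_iff_rpow_le (by norm_num) hn0]
    norm_num
    linarith
  have hlogn : Real.log n ≤ y := by
    have h2 : Real.log n = y * Real.log 2 := by
      rw [hy, Real.logb, div_mul_cancel₀ _ (Real.log_pos (by norm_num)).ne']
    have := Real.log_two_lt_d9
    rw [h2]
    nlinarith
  set ℓ : ℝ := Real.logb 2 y / Real.logb 2 L with hℓ
  have hℓ' : ℓ = Real.log y / Real.log L := by
    rw [hℓ, Real.logb, Real.logb, div_div_div_cancel_right₀ (Real.log_pos (by norm_num)).ne']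
  have hlogL : 0 < Real.log L := Real.log_pos (by linarith)
  have hlogy : 0 < Real.log y := Real.log_pos (by linarith)
  have hℓ0 : 0 < ℓ := by rw [hℓ']; exact div_pos hlogy hlogL
  have hMℓ : 0 ≤ 24 * (M : ℝ) * ℓ := by positivity
  rw [le_div_iff₀ (by positivity)]
  by_cases hcase : 34 * Real.log n ≤ d
  · have h1 : ((M : ℝ) + 1) * (34 * Real.log n) ≤ (M + 1) * d :=
      mul_le_mul_of_nonneg_left hcase (by positivity)
    have h2 : (d : ℝ) * (M + 1) ≤ d * (2 * (x - M)) := mul_le_mul_of_nonneg_left (by linarith) hd0.le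
    nlinarith
  · have hdy : (d : ℝ) ≤ y ^ 3 := by
      have : (34 : ℝ) ≤ y ^ 2 := by nlinarith
      nlinarith
    have hℓ3 : 1 / 3 ≤ ℓ := by
      rw [hℓ', div_le_div_iff₀ (by norm_num) hlogL]
      have h1 : Real.log L ≤ Real.log (y ^ 3) := Real.log_le_log (by linarith) (hLd.trans hdy)
      rw [Real.log_pow] at h1
      push_cast at h1
      linarith
    set t : ℕ := ⌈6 * ℓ⌉₊ with ht
    have ht1 : 6 * ℓ ≤ t := Nat.le_ceil _
    have ht2 : (t : ℝ) < 6 * ℓ + 1 := Nat.ceil_lt_add_one (by positivity)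
    have htM : (t : ℝ) * M ≤ (6 * ℓ + 1) * M := mul_le_mul_of_nonneg_right ht2.le (by linarith)
    have hMℓ3 : (M : ℝ) * (1 / 3) ≤ M * ℓ := mul_le_mul_of_nonneg_left hℓ3 (by linarith)
    have hw := hgrow t (by linarith)
    have hρ : 39 * (d : ℝ) / (100 * lam) = 39 / 100 * L := by rw [hL, mul_div_mul_comm]
    have hpow : y ^ 3 ≤ ((39 * (d : ℝ) / (100 * lam)) ^ 2) ^ t := by
      rw [hρ]
      exact cube_le_pow_of_log_ratio_le (by linarith) hL5 (by rwa [← hℓ'])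
    have h1 : (M : ℝ) * y ^ 3 ≤ w := (mul_le_mul_of_nonneg_left hpow (by positivity)).trans hw
    have h2 : 32 * y ≤ y ^ 3 := by
      have : (32 : ℝ) ≤ y ^ 2 := by nlinarith
      nlinarith
    have h3 : (M : ℝ) * (32 * y) ≤ M * y ^ 3 := mul_le_mul_of_nonneg_left h2 (by positivity)
    have h4 : (M : ℝ) * Real.log n ≤ M * y := mul_le_mul_of_nonneg_left hlogn (by linarith)
    have h5 : Real.log n ≤ M * Real.log n :=
      le_mul_of_one_le_left (Real.log_nonneg (by linarith)) hM'
    linarith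

/-- The expansion of a single vertex into its neighbourhood bounds `lam` from below. -/
lemma sqrt_le_two_mul_lam {d : ℕ} {lam : ℝ} (h : IsLambdaExpander G d lam) (v : V)
    (hdn : 2 * d ≤ Fintype.card V) (hd : 0 < d) : √(d : ℝ) ≤ 2 * lam := by
  have hn : (0 : ℝ) < Fintype.card V := by exact_mod_cast Fintype.card_pos_iff.2 ⟨v⟩
  have h1 := (abs_le.1 (h.2 {v} (G.neighborFinset v))).2
  rw [card_interedges_eq_sum] at h1
  simp only [sum_singleton, inter_self, card_singleton, Nat.cast_one, mul_one, one_mul,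
    card_neighborFinset_of_regular h.1] at h1
  have hdn' : 2 * (d : ℝ) ≤ Fintype.card V := by exact_mod_cast hdn
  have h2 : (d : ℝ) / Fintype.card V * d ≤ d / 2 := by
    rw [div_mul_eq_mul_div, div_le_iff₀ hn]
    have : (0 : ℝ) ≤ d := by positivity
    nlinarith
  have hsq : 0 < √(d : ℝ) := Real.sqrt_pos.2 (by exact_mod_cast hd)
  have h3 : √(d : ℝ) * √d = d := Real.mul_self_sqrt (by positivity)
  have h4 : √(d : ℝ) * √d ≤ 2 * lam * √d := by linarith
  exact le_of_mul_le_mul_right h4 hsq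

/-- The hypothesis on `M` bounds `M` by a small multiple of `d / log d`. -/
lemma parameters_of_le {d M : ℕ} {lam : ℝ} (hM : 1 ≤ M) (hlam : 0 < d → √(d : ℝ) ≤ 2 * lam)
    (h : (M : ℝ) ≤ 1 / 120000 * ((d : ℝ) ^ (3 / 2 : ℝ) / (lam * Real.logb 2 d))) :
    30000 ≤ d ∧ 30000 * Real.log d * (M + 1) ≤ d ∧ 1 ≤ lam := by
  have hM' : (1 : ℝ) ≤ M := by exact_mod_cast hM
  have hd2 : 2 ≤ d := by
    by_contra hlt
    interval_cases d
    · rw [Nat.cast_zero, Real.zero_rpow (by norm_num)] at h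
      norm_num at h
      linarith
    · norm_num at h
      linarith
  have hd2' : (2 : ℝ) ≤ d := by exact_mod_cast hd2
  have hd0 : (0 : ℝ) < d := by linarith
  have hlam' := hlam (by omega)
  have hs : 0 < √(d : ℝ) := Real.sqrt_pos.2 hd0
  have hlog2 : Real.log 2 ≤ Real.log d := Real.log_le_log (by norm_num) hd2'
  have hl2 := Real.log_two_gt_d9
  have hl2' := Real.log_two_lt_d9
  have hlogb : Real.log d ≤ Real.logb 2 d := by
    rw [Real.logb, le_div_iff₀ (by linarith)]
    nlinarith
  have hlogpos : 0 < Real.log d := by linarith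
  have hrpow : (d : ℝ) ^ (3 / 2 : ℝ) = d * √d := by
    rw [Real.sqrt_eq_rpow, show (3 / 2 : ℝ) = 1 + 1 / 2 by norm_num, Real.rpow_add hd0,
      Real.rpow_one]
  have hbound : (d : ℝ) ^ (3 / 2 : ℝ) / (lam * Real.logb 2 d) ≤ 2 * d / Real.log d := by
    have hlam00 : 0 < lam := by linarith
    rw [hrpow, div_le_div_iff₀ (mul_pos (by linarith) (by linarith)) hlogpos]
    calc (d : ℝ) * √d * Real.log d ≤ d * (2 * lam) * Real.logb 2 d := by gcongr
      _ = 2 * d * (lam * Real.logb 2 d) := by ring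
  have hMd : (M : ℝ) ≤ 1 / 120000 * (2 * d / Real.log d) :=
    h.trans (mul_le_mul_of_nonneg_left hbound (by norm_num))
  have hMd' : 60000 * Real.log d * M ≤ d := by
    have := mul_le_mul_of_nonneg_right hMd hlogpos.le
    have e : 1 / 120000 * (2 * (d : ℝ) / Real.log d) * Real.log d = d / 60000 := by
      field_simp
      norm_num
    rw [e] at this
    linarith
  have hbig : 30000 * Real.log d * (M + 1) ≤ d := by nlinarith
  have hd3 : (30000 : ℝ) ≤ d := by nlinarith
  refine ⟨by exact_mod_cast hd3, hbig, ?_⟩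
  have : (2 : ℝ) ≤ √d := Real.le_sqrt_of_sq_le (by linarith)
  linarith

end Tails

end FlatLipschitz

open FlatLipschitz in
theorem theorem1p2 :
    ∃ c C c' C' K : ℝ, 0 < c ∧ 0 < C ∧ 0 < c' ∧ 0 < C' ∧ 0 < K ∧
      ∀ (V : Type*) [Fintype V] (G : SimpleGraph V) [DecidableRel G.Adj]
        (n d M : ℕ) (lam : ℝ) (v₀ : V),
        Fintype.card V = n →
        G.Connected →
        IsLambdaExpander G d lam →
        lam ≤ (d : ℝ) / 5 →
        (d : ℝ) / 5 ≤ c * (n : ℝ) →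
        1 ≤ M →
        (M : ℝ) ≤ min (c * ((d : ℝ) ^ (3 / 2 : ℝ) / (lam * Real.logb 2 (d : ℝ))))
          (Real.logb 2 (n : ℝ) ^ C) →
        (uniformLipschitz G v₀ M).real
            {f | C' * (M : ℝ) * (Real.logb 2 (Real.logb 2 (n : ℝ)) / Real.logb 2 ((d : ℝ) / lam))
                + 2 * ((M : ℝ) + 1) ≤ (functionRange f : ℝ)}
          ≤ (n : ℝ) ^ (-c') ∧
        ∀ v : V,
          ProbabilityTheory.variance (fun f : V → ℤ => (f v : ℝ)) (uniformLipschitz G v₀ M)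
            ≤ K * ((M : ℝ) *
                ((max 1 ⌈Real.logb 2 (M : ℝ) / Real.logb 2 ((d : ℝ) / (2 * lam))⌉ : ℤ) : ℝ)) ^ 2 := by
  -- the bound `lam ≥ √d / 2` reduces the condition on `M` to `M ≤ 2 c d / log d`, and `c` makes this
  -- small enough for the sum over records; the exponent `C` plays no role in the estimates
  refine ⟨1 / 120000, 1, 1, 24, 16, by norm_num, by norm_num, by norm_num, by norm_num,
    by norm_num, ?_⟩
  intro V _ G _ n d M lam v₀ hn hconn h hlam hdn hM hMle
  classical
  subst hn
  have : Nonempty V := ⟨v₀⟩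
  have hcardpos : 0 < Fintype.card V := Fintype.card_pos
  have hdn2 : 2 * d ≤ Fintype.card V := by
    have h1 : (0 : ℝ) ≤ Fintype.card V := by positivity
    have : 2 * (d : ℝ) ≤ Fintype.card V := by linarith
    exact_mod_cast this
  obtain ⟨hd, hbig, hlam1⟩ := parameters_of_le hM (sqrt_le_two_mul_lam h v₀ hdn2)
    (hMle.trans (min_le_left _ _))
  have hlam0 : 0 < lam := by linarith
  have hM' : (1 : ℝ) ≤ M := by exact_mod_cast hM
  set 𝓛 : Finset (V → ℤ) := (finite_lipschitzFunctions hconn v₀ M).toFinset with h𝓛def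
  have hcoe : (𝓛 : Set (V → ℤ)) = lipschitzFunctions G v₀ M := by simp [h𝓛def]
  have h𝓛 : ∀ f, f ∈ 𝓛 ↔ f v₀ = 0 ∧ ∀ u v, G.Adj u v → |f u - f v| ≤ (M : ℤ) := by
    intro f
    simp [h𝓛def, lipschitzFunctions]
  have hne : 𝓛.Nonempty := ⟨0, (h𝓛 0).2 ⟨rfl, by simp⟩⟩
  have hcard : (0 : ℝ) < 𝓛.card := by exact_mod_cast Finset.card_pos.2 hne
  obtain ⟨s, W, hW, hsum⟩ := exists_excursion_weight h hconn hd hbig hlam0 hlam h𝓛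
  rw [uniformLipschitz, ← hcoe]
  constructor
  · rw [uniformOn_real_eq, div_le_iff₀ hcard]
    have hexp : (Fintype.card V : ℝ) * Real.exp (-(2 * Real.log (Fintype.card V)))
        = (Fintype.card V : ℝ) ^ (-1 : ℝ) := by
      have hn0 : (0 : ℝ) < Fintype.card V := by exact_mod_cast hcardpos
      rw [Real.rpow_def_of_pos hn0]
      nth_rewrite 1 [← Real.exp_log hn0]
      rw [← Real.exp_add]
      congr 1
      ring
    rw [← hexp]
    refine card_heavy_le hsum _ (Finset.filter_subset _ _) fun f hf => ?_
    obtain ⟨hf𝓛, hrange⟩ := Finset.mem_filter.1 hf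
    obtain ⟨p, hp⟩ := exists_eq_ciSup_of_finite (f := f)
    obtain ⟨q, hq⟩ := exists_eq_ciInf_of_finite (f := f)
    rw [functionRange, ← hp, ← hq] at hrange
    push_cast at hrange
    set ℓ : ℝ := Real.logb 2 (Real.logb 2 (Fintype.card V : ℝ)) / Real.logb 2 ((d : ℝ) / lam)
      with hℓ
    have hℓ0 : 0 ≤ 24 * (M : ℝ) * ℓ := by
      have h1 : (2 : ℝ) ≤ Fintype.card V := by exact_mod_cast (by omega : 2 ≤ Fintype.card V)
      have h2 : 1 ≤ Real.logb 2 (Fintype.card V : ℝ) := by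
        rw [Real.le_logb_iff_rpow_le (by norm_num) (by linarith)]
        simpa using h1
      have h3 : 1 ≤ (d : ℝ) / lam := by
        rw [le_div_iff₀ hlam0]
        linarith
      exact mul_nonneg (by positivity)
        (div_nonneg (Real.logb_nonneg (by norm_num) h2) (Real.logb_nonneg (by norm_num) h3))
    -- one of the two extreme values is far from the bulk
    obtain ⟨v, b, hvb⟩ : ∃ v b, 24 * (M : ℝ) * ℓ + M + 1
        ≤ 2 * ((side M b (fun u => f u + s f) v : ℝ) - M) := by
      by_contra hcon
      push Not at hcon
      have h1 := hcon p true
      have h2 := hcon q false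
      simp only [side, if_true, Bool.false_eq_true, if_false] at h1 h2
      push_cast at h1 h2
      linarith
    have hbad : ¬(0 ≤ f v + s f ∧ f v + s f ≤ M) := by
      intro hgood
      have h1 : side M b (fun u => f u + s f) v ≤ M := by
        cases b
        · simp only [side, Bool.false_eq_true, if_false]; omega
        · simp only [side, if_true]; omega
      have h2 : (side M b (fun u => f u + s f) v : ℝ) ≤ M := by exact_mod_cast h1
      linarith
    refine ⟨v, hbad, ?_⟩
    obtain ⟨hlin, hgrow⟩ := hW f hf𝓛 v hbad b
    refine two_mul_log_le_weight hd (by omega) hM hlam0 hlam1 hlam hvb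
      (by exact_mod_cast hlin) fun t ht => hgrow t (by exact_mod_cast ht)
  · intro v
    have hprob : MeasureTheory.IsProbabilityMeasure
        (ProbabilityTheory.uniformOn (𝓛 : Set (V → ℤ))) :=
      ProbabilityTheory.isProbabilityMeasure_uniformOn 𝓛.finite_toSet (by exact_mod_cast hne)
    have hmeas : Measurable fun f : V → ℤ => (f v : ℝ) := by fun_prop
    have hsq := fun u => sum_sq_centred_le hd hbig hM u
      (fun f hf hbad b => (hW f hf u hbad b).1) (hsum u)
    have hsecond : ∑ f ∈ 𝓛, (f v : ℝ) ^ 2 ≤ 16 * (M : ℝ) ^ 2 * 𝓛.card := by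
      calc ∑ f ∈ 𝓛, (f v : ℝ) ^ 2
          ≤ ∑ f ∈ 𝓛, (2 * ((f v + s f : ℤ) : ℝ) ^ 2 + 2 * ((f v₀ + s f : ℤ) : ℝ) ^ 2) := by
            refine Finset.sum_le_sum fun f hf => ?_
            have h0 : f v₀ = 0 := ((h𝓛 f).1 hf).1
            rw [h0]
            push_cast
            nlinarith [sq_nonneg ((f v : ℝ) + s f + s f)]
        _ = 2 * ∑ f ∈ 𝓛, ((f v + s f : ℤ) : ℝ) ^ 2 + 2 * ∑ f ∈ 𝓛, ((f v₀ + s f : ℤ) : ℝ) ^ 2 := by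
            rw [Finset.sum_add_distrib, Finset.mul_sum, Finset.mul_sum]
        _ ≤ _ := by
            have h1 := hsq v
            have h2 := hsq v₀
            linarith
    have hmax : (1 : ℝ) ≤
        ((max 1 ⌈Real.logb 2 (M : ℝ) / Real.logb 2 ((d : ℝ) / (2 * lam))⌉ : ℤ) : ℝ) := by
      exact_mod_cast le_max_left _ _
    calc _ ≤ _ := ProbabilityTheory.variance_le_expectation_sq hmeas.aestronglyMeasurable
      _ = (∑ f ∈ 𝓛, (f v : ℝ) ^ 2) / 𝓛.card :=
          integral_uniformOn_eq 𝓛 fun f : V → ℤ => (f v : ℝ) ^ 2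
      _ ≤ 16 * (M : ℝ) ^ 2 := by rw [div_le_iff₀ hcard]; exact hsecond
      _ ≤ _ := by
          refine mul_le_mul_of_nonneg_left (pow_le_pow_left₀ (by linarith) ?_ 2) (by norm_num)
          exact le_mul_of_one_le_right (by linarith) hmax
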